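/- Let $p$ be a prime and let $G$ be an abelian group of order $p^2$ and exponent $p$ (so $G\cong C_p\times C_p$). A supercharacter theory of a finite abelian group $H$ is a pair $\mathsf{S}=(\mathcal{X},\mathcal{K})$, where $\mathcal{X}$ is a partition of $\mathrm{Irr}(H)$ and $\mathcal{K}$ is a partition of $H$ (into superclasses), such that $|\mathcal{X}|=|\mathcal{K}|$, $\{1\}\in\mathcal{K}$, and for every $X\in\mathcal{X}$ there is a nonzero character with all constituents in $X$ that is constant on the members of $\mathcal{K}$. Its supercharacters are the functions $\sigma_X=\sum_{\psi\in X}\psi$, $X\in\mathcal{X}$. For a supercharacter theory $\mathsf{S}$ of $G$ let $Z(\mathsf{S})$ be the subgroup of all $g\in G$ for which $\{g\}$ is a superclass, and let $[G,\mathsf{S}]$ be the subgroup generated by all $g^{-1}k$ with $g,k$ in the same superclass. For a subgroup $N$ of $G$, $\mathsf{S}$ is a $\ast$-product over $N$ if there are supercharacter theories $\mathsf{U}$ of $N$ and $\mathsf{V}$ of $G/N$ such that the superclasses of $\mathsf{S}$ are the superclasses of $\mathsf{U}$ together with the full preimages in $G$ of the nonidentity superclasses of $\mathsf{V}$, and the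 supercharacters of $\mathsf{S}$ are the inflations to $G$ of the supercharacters of $\mathsf{V}$ together with the characters induced to $G$ from the nonprincipal supercharacters of $\mathsf{U}$. If $G$ is the internal direct product of subgroups $H$ and $N$, and $\mathsf{E},\mathsf{F}$ are supercharacter theories of $H,N$, then $\mathsf{S}=\mathsf{E}\times\mathsf{F}$ means that the superclasses of $\mathsf{S}$ are the products $KL$ of superclasses $K$ of $\mathsf{E}$ and $L$ of $\mathsf{F}$, and its supercharacters are the products $\chi\times\xi$ of supercharacters of $\mathsf{E}$ and $\mathsf{F}$. For a subgroup $N$ that is a union of superclasses, $\mathsf{S}_N$ is the supercharacter theory of $N$ whose superclasses are the superclasses of $\mathsf{S}$ contained in $N$ and whose supercharacters are, up to nonzero constants, the restrictions of those of $\mathsf{S}$. Finally, $\mathsf{S}$ comes from automorphisms if there is $A\le\mathrm{Aut}(G)$ such that $\mathcal{K}$ is the set of $A$-orbits on $G$ and $\mathcal{X}$ is the set of $A$-orbits on $\mathrm{Irr}(G)$, where $\chi^a(g)=\chi(a^{-1}(g))$. Theorem. Let $\mathsf{S}$ be a supercharacter theory of $G$. Then $[G,\mathsf{S}]<G$ if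 and only if $\mathsf{S}$ has a nonprincipal linear supercharacter, and $Z(\mathsf{S})>1$ if and only if $\mathsf{S}$ has a nonidentity superclass of size one. If $[G,\mathsf{S}]<G$ or $Z(\mathsf{S})>1$, then at least one of the following holds: 1. $[G,\mathsf{S}]<G$ and $\mathsf{S}$ is a $\ast$-product over $[G,\mathsf{S}]$; 2. $Z(\mathsf{S})>1$ and $\mathsf{S}$ is a $\ast$-product over $Z(\mathsf{S})$; 3. $G$ is the internal direct product of $Z(\mathsf{S})$ and $[G,\mathsf{S}]$, and $\mathsf{S}=\mathsf{S}_{Z(\mathsf{S})}\times\mathsf{S}_{[G,\mathsf{S}]}$. Moreover, if $[G,\mathsf{S}]<G$ or $Z(\mathsf{S})>1$, then $\mathsf{S}$ comes from automorphisms. -/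

import Mathlib

/-- A supercharacter theory of a finite abelian group `G`.  The irreducible complex characters of
a finite abelian group are its linear characters, i.e. the homomorphisms `G →* ℂˣ`.
A (nonzero) character with constituents in `X` is a nonzero sum of members of `X` with
multiplicities in `ℕ`. -/
structure SupercharacterTheory (G : Type*) [CommGroup G] [Finite G] where
  /-- The partition of the set of irreducible characters. -/
  charParts : Set (Set (G →* ℂˣ))
  /-- The partition of the group into superclasses. -/
  classes : Set (Set G)
  isPartition_charParts : Setoid.IsPartition charParts
  isPartition_classes : Setoid.IsPartition classes
  ncard_eq : charParts.ncard = classes.ncard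
  singleton_one_mem : {1} ∈ classes
  exists_character : ∀ X ∈ charParts, ∃ n : (G →* ℂˣ) →₀ ℕ, n ≠ 0 ∧ (∀ ψ ∈ n.support, ψ ∈ X) ∧
    ∀ K ∈ classes, ∀ g ∈ K, ∀ h ∈ K,
      (n.sum fun ψ k => (k : ℂ) * (ψ g : ℂ)) = n.sum fun ψ k => (k : ℂ) * (ψ h : ℂ)

namespace SupercharacterTheory

section Helpers

variable {G : Type*} [CommGroup G] [Finite G]

theorem exists_multiplicity (S : SupercharacterTheory G) [Fintype (G →* ℂˣ)] :
    ∃ n : S.charParts → (G →* ℂˣ) → ℕ, (∀ X, ∃ ψ, n X ψ ≠ 0) ∧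
      (∀ X ψ, n X ψ ≠ 0 → ψ ∈ (X : Set (G →* ℂˣ))) ∧
      ∀ X, ∀ K ∈ S.classes, ∀ g ∈ K, ∀ h ∈ K,
        ∑ ψ, (n X ψ : ℂ) * (ψ g : ℂ) = ∑ ψ, (n X ψ : ℂ) * (ψ h : ℂ) := by
  choose n h0 hs hc using S.exists_character
  refine ⟨fun X => n X X.2, fun X => ?_, fun X ψ hψ => ?_, fun X K hK g hg h hh => ?_⟩
  · by_contra! H
    exact h0 X X.2 (Finsupp.ext H)
  · exact hs X X.2 ψ (Finsupp.mem_support_iff.2 hψ)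
  · have := hc X X.2 K hK g hg h hh
    rwa [Finsupp.sum_fintype _ _ (by simp), Finsupp.sum_fintype _ _ (by simp)] at this

theorem coeff_ext {G : Type*} [CommGroup G] [Fintype (G →* ℂˣ)] (a b : (G →* ℂˣ) → ℂ)
    (h : ∀ x : G, ∑ ψ, a ψ * (ψ x : ℂ) = ∑ ψ, b ψ * (ψ x : ℂ)) : a = b := by
  have hinj : Function.Injective (fun ψ : G →* ℂˣ => (Units.coeHom ℂ).comp ψ) := by
    intro ψ φ e
    ext x
    exact DFunLike.congr_fun e x
  have hli := (linearIndependent_monoidHom G ℂ).comp _ hinj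
  rw [Fintype.linearIndependent_iff] at hli
  have := hli (fun ψ => a ψ - b ψ) (by
    funext x
    simp only [Finset.sum_apply, Pi.smul_apply, Function.comp_apply, smul_eq_mul, sub_mul,
      Finset.sum_sub_distrib, Pi.zero_apply]
    rw [sub_eq_zero]
    exact h x)
  funext ψ
  exact sub_eq_zero.1 (this ψ)

theorem sum_char_mul [Fintype (G →* ℂˣ)] (g x : G) [Decidable (x = g)] :
    ∑ ψ : G →* ℂˣ, ((ψ g)⁻¹ : ℂ) * (ψ x : ℂ) = if x = g then (Nat.card G : ℂ) else 0 := by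
  split_ifs with h
  · subst h
    simp [← Nat.card_eq_fintype_card, CommGroup.card_monoidHom_of_hasEnoughRootsOfUnity]
  · have h' : g⁻¹ * x ≠ 1 := fun e => h (inv_mul_eq_one.1 e).symm
    obtain ⟨φ, hφ⟩ := CommGroup.exists_apply_ne_one_of_hasEnoughRootsOfUnity G ℂ h'
    have key : ∀ ψ : G →* ℂˣ, ((ψ g)⁻¹ : ℂ) * (ψ x : ℂ) = (ψ (g⁻¹ * x) : ℂ) := by
      intro ψ; simp
    simp_rw [key]
    have e : ∑ ψ : G →* ℂˣ, (ψ (g⁻¹ * x) : ℂ) =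
        (φ (g⁻¹ * x) : ℂ) * ∑ ψ : G →* ℂˣ, (ψ (g⁻¹ * x) : ℂ) := by
      rw [Finset.mul_sum, ← Equiv.sum_comp (Equiv.mulLeft φ)]
      simp
    have h1 : (φ (g⁻¹ * x) : ℂ) ≠ 1 := fun e => hφ (Units.ext e)
    have h2 : ((φ (g⁻¹ * x) : ℂ) - 1) * ∑ ψ : G →* ℂˣ, (ψ (g⁻¹ * x) : ℂ) = 0 := by
      rw [sub_mul, one_mul, ← e, sub_self]
    exact (mul_eq_zero.1 h2).resolve_left (sub_ne_zero.2 h1)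

theorem sum_charParts (S : SupercharacterTheory G) [Fintype S.charParts]
    {n : S.charParts → (G →* ℂˣ) → ℕ}
    (hn : ∀ X ψ, n X ψ ≠ 0 → ψ ∈ (X : Set (G →* ℂˣ))) (c : S.charParts → ℂ)
    (X : S.charParts) (ψ : G →* ℂˣ) (hψ : ψ ∈ (X : Set (G →* ℂˣ))) :
    ∑ Y, c Y * (n Y ψ : ℂ) = c X * (n X ψ : ℂ) := by
  refine Finset.sum_eq_single X (fun Y _ hY => ?_) (by simp)
  rw [mul_eq_zero]
  right
  by_contra h
  have h' : n Y ψ ≠ 0 := fun e => h (by simp [e])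
  exact hY (Subtype.ext ((S.isPartition_charParts.2 ψ).unique ⟨Y.2, hn Y ψ h'⟩ ⟨X.2, hψ⟩))

theorem exists_coeff (S : SupercharacterTheory G) [Fintype (G →* ℂˣ)] [Fintype S.charParts]
    {n : S.charParts → (G →* ℂˣ) → ℕ} (h0 : ∀ X, ∃ ψ, n X ψ ≠ 0)
    (hn : ∀ X ψ, n X ψ ≠ 0 → ψ ∈ (X : Set (G →* ℂˣ)))
    (hc : ∀ X, ∀ K ∈ S.classes, ∀ g ∈ K, ∀ h ∈ K,
        ∑ ψ, (n X ψ : ℂ) * (ψ g : ℂ) = ∑ ψ, (n X ψ : ℂ) * (ψ h : ℂ))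
    (f : G → ℂ) (hf : ∀ K ∈ S.classes, ∀ g ∈ K, ∀ h ∈ K, f g = f h) :
    ∃ c : S.charParts → ℂ, ∀ x, f x = ∑ ψ, (∑ X, c X * (n X ψ : ℂ)) * (ψ x : ℂ) := by
  classical
  have : Fintype S.classes := Fintype.ofFinite _
  have hne : ∀ K : S.classes, (K : Set G).Nonempty := fun K =>
    Setoid.nonempty_of_mem_partition S.isPartition_classes K.2
  choose rep hrep using hne
  have swap : ∀ (c : S.charParts → ℂ) (x : G),
      ∑ ψ : G →* ℂˣ, (∑ X, c X * (n X ψ : ℂ)) * (ψ x : ℂ) =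
        ∑ X, c X * ∑ ψ, (n X ψ : ℂ) * (ψ x : ℂ) := by
    intro c x
    simp_rw [Finset.sum_mul, Finset.mul_sum, mul_assoc]
    exact Finset.sum_comm
  have hcl : ∀ x : G, ∃ K : S.classes, x ∈ (K : Set G) := fun x => by
    obtain ⟨K, ⟨hK, hx⟩, -⟩ := S.isPartition_classes.2 x
    exact ⟨⟨K, hK⟩, hx⟩
  let v : S.charParts → (S.classes → ℂ) := fun X K => ∑ ψ, (n X ψ : ℂ) * (ψ (rep K) : ℂ)
  have hli : LinearIndependent ℂ v := by
    rw [Fintype.linearIndependent_iff]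
    intro c hcz X
    have hz : ∀ x : G, ∑ X, c X * ∑ ψ, (n X ψ : ℂ) * (ψ x : ℂ) = 0 := by
      intro x
      obtain ⟨K, hK⟩ := hcl x
      have := congrFun hcz K
      simp only [Finset.sum_apply, Pi.smul_apply, smul_eq_mul, Pi.zero_apply, v] at this
      rw [← this]
      exact Finset.sum_congr rfl fun X _ => by rw [hc X K K.2 x hK (rep K) (hrep K)]
    have hcoef := coeff_ext (fun ψ : G →* ℂˣ => ∑ X, c X * (n X ψ : ℂ)) (fun _ => 0) (by
      intro x
      rw [swap, hz]
      simp)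
    obtain ⟨ψ, hψ⟩ := h0 X
    have := congrFun hcoef ψ
    beta_reduce at this
    rw [S.sum_charParts hn c X ψ (hn X ψ hψ)] at this
    exact (mul_eq_zero.1 this).resolve_right (by exact_mod_cast hψ)
  have hcard : Fintype.card S.charParts = Module.finrank ℂ (S.classes → ℂ) := by
    rw [Module.finrank_fintype_fun_eq_card, ← Nat.card_eq_fintype_card,
      ← Nat.card_eq_fintype_card]
    exact S.ncard_eq
  have hspan := hli.span_eq_top_of_card_eq_finrank' hcard
  have hmem : (fun K => f (rep K)) ∈ Submodule.span ℂ (Set.range v) := by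
    rw [hspan]; trivial
  obtain ⟨c, hcv⟩ := (Submodule.mem_span_range_iff_exists_fun ℂ).1 hmem
  refine ⟨c, fun x => ?_⟩
  obtain ⟨K, hK⟩ := hcl x
  rw [swap, hf K K.2 x hK (rep K) (hrep K), ← congrFun hcv K]
  simp only [Finset.sum_apply, Pi.smul_apply, smul_eq_mul, v]
  exact Finset.sum_congr rfl fun X _ => by rw [hc X K K.2 x hK (rep K) (hrep K)]

/-- An element forms a superclass by itself if and only if the characters in each part of the
partition of the characters agree on it. -/
theorem singleton_mem_classes_iff (S : SupercharacterTheory G) (g : G) :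
    {g} ∈ S.classes ↔ ∀ X ∈ S.charParts, ∀ ψ ∈ X, ∀ φ ∈ X, ψ g = φ g := by
  classical
  have : Fintype (G →* ℂˣ) := Fintype.ofFinite _
  have : Fintype S.charParts := Fintype.ofFinite _
  obtain ⟨n, h0, hn, hc⟩ := S.exists_multiplicity
  have hG : (Nat.card G : ℂ) ≠ 0 := by exact_mod_cast Nat.card_pos.ne'
  have coef : ∀ g : G, {g} ∈ S.classes → ∃ c : S.charParts → ℂ,
      ∀ X : S.charParts, ∀ ψ ∈ (X : Set (G →* ℂˣ)), ((ψ g)⁻¹ : ℂ) = c X * (n X ψ : ℂ) := by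
    intro g hg
    obtain ⟨c, hcc⟩ := S.exists_coeff h0 hn hc
      (fun x => if x = g then (Nat.card G : ℂ) else 0) (by
        intro K hK a ha b hb
        have : a = g ↔ b = g := by
          constructor
          · rintro rfl
            have : K = {a} := (S.isPartition_classes.2 a).unique ⟨hK, ha⟩ ⟨hg, rfl⟩
            rw [this] at hb; exact hb
          · rintro rfl
            have : K = {b} := (S.isPartition_classes.2 b).unique ⟨hK, hb⟩ ⟨hg, rfl⟩
            rw [this] at ha; exact ha
        simp only [this])
    have := coeff_ext (fun ψ : G →* ℂˣ => ((ψ g)⁻¹ : ℂ)) _ (fun x => by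
      rw [← hcc x]; exact sum_char_mul g x)
    refine ⟨c, fun X ψ hψ => ?_⟩
    rw [← S.sum_charParts hn c X ψ hψ]
    exact congrFun this ψ
  constructor
  · intro hg X hX ψ hψ φ hφ
    obtain ⟨c, h⟩ := coef g hg
    obtain ⟨d, h'⟩ := coef 1 S.singleton_one_mem
    have a1 := h ⟨X, hX⟩ ψ hψ
    have a2 := h ⟨X, hX⟩ φ hφ
    have b1 := h' ⟨X, hX⟩ ψ hψ
    have b2 := h' ⟨X, hX⟩ φ hφ
    simp only [map_one, Units.val_one, inv_one] at b1 b2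
    have hd : d ⟨X, hX⟩ ≠ 0 := fun e => by simp [e] at b1
    have hnn := mul_left_cancel₀ hd (b1.symm.trans b2)
    rw [hnn, ← a2] at a1
    exact Units.ext (inv_injective a1)
  · intro H
    obtain ⟨d, h'⟩ := coef 1 S.singleton_one_mem
    choose r hr using fun X : S.charParts =>
      Setoid.nonempty_of_mem_partition S.isPartition_charParts X.2
    have key : ∀ x : G, (if x = g then (Nat.card G : ℂ) else 0) =
        ∑ X : S.charParts, (((r X) g)⁻¹ : ℂ) * d X * ∑ ψ, (n X ψ : ℂ) * (ψ x : ℂ) := by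
      intro x
      rw [← sum_char_mul]
      simp_rw [Finset.mul_sum, ← mul_assoc]
      rw [Finset.sum_comm]
      refine Finset.sum_congr rfl fun ψ _ => ?_
      rw [← Finset.sum_mul]
      congr 1
      obtain ⟨X, ⟨hX, hψ⟩, -⟩ := S.isPartition_charParts.2 ψ
      rw [S.sum_charParts hn _ ⟨X, hX⟩ ψ hψ, mul_assoc, ← h' ⟨X, hX⟩ ψ hψ,
        H X hX ψ hψ _ (hr ⟨X, hX⟩)]
      simp
    obtain ⟨K, ⟨hK, hgK⟩, -⟩ := S.isPartition_classes.2 g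
    have : K = {g} := by
      refine Set.eq_singleton_iff_unique_mem.2 ⟨hgK, fun x hx => ?_⟩
      by_contra hxg
      have e1 := key x
      have e2 := key g
      rw [if_neg hxg] at e1
      rw [if_pos rfl] at e2
      apply hG
      rw [e2, e1]
      exact Finset.sum_congr rfl fun X _ => by rw [hc X K hK g hgK x hx]
    rwa [← this]

end Helpers

section Definitions

variable {G : Type*} [CommGroup G] [Finite G]

/-- The basic characters (supercharacters) `σ_X = ∑_{ψ ∈ X} ψ(1) ψ`, for `X` a part of the
partition of the irreducible characters, as functions on `G`; here every `ψ(1)` is `1`. -/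
def supercharacters (S : SupercharacterTheory G) : Set (G → ℂ) :=
  {χ | ∃ X ∈ S.charParts, χ = fun g => ∑ᶠ ψ ∈ X, (ψ g : ℂ)}

/-- The subgroup `Z(S)` formed by the superclasses of size one. -/
def center (S : SupercharacterTheory G) : Subgroup G where
  carrier := {g | ({g} : Set G) ∈ S.classes}
  one_mem' := by
    simpa only [Set.mem_ofPred_eq] using S.singleton_one_mem
  mul_mem' := by
    intro a b ha hb
    simp only [Set.mem_ofPred_eq, singleton_mem_classes_iff] at ha hb ⊢
    intro X hX ψ hψ φ hφ
    rw [map_mul, map_mul, ha X hX ψ hψ φ hφ, hb X hX ψ hψ φ hφ]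
  inv_mem' := by
    intro a ha
    simp only [Set.mem_ofPred_eq, singleton_mem_classes_iff] at ha ⊢
    intro X hX ψ hψ φ hφ
    rw [map_inv, map_inv, ha X hX ψ hψ φ hφ]

/-- The subgroup `[G, S]` generated by all `g⁻¹ k` with `g`, `k` in the same superclass. -/
def commutator (S : SupercharacterTheory G) : Subgroup G :=
  Subgroup.closure {x | ∃ K ∈ S.classes, ∃ g ∈ K, ∃ k ∈ K, x = g⁻¹ * k}

open scoped Classical in
/-- The class function of `G` induced from a function `f` on the subgroup `N`,
`f^G(g) = |N|⁻¹ ∑_{x ∈ G} f°(x g x⁻¹)`, where `f°` is `f` extended by zero. -/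
noncomputable def induced (N : Subgroup G) (f : N → ℂ) : G → ℂ := fun g =>
  (Nat.card N : ℂ)⁻¹ * ∑ᶠ x : G, if h : x * g * x⁻¹ ∈ N then f ⟨x * g * x⁻¹, h⟩ else 0

/-- `S` is the `∗`-product of the supercharacter theory `U` of the subgroup `N` and the
supercharacter theory `V` of `G ⧸ N`.  (The conjugation action of `G` on `N` is trivial.) -/
structure IsStarProduct (S : SupercharacterTheory G) (N : Subgroup G)
    (U : SupercharacterTheory N) (V : SupercharacterTheory (G ⧸ N)) : Prop where
  classes_eq : S.classes =
    {K | ∃ L ∈ U.classes, K = (fun x : N => (x : G)) '' L} ∪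
    {K | ∃ L ∈ V.classes, L ≠ {1} ∧ K = (fun g : G => (g : G ⧸ N)) ⁻¹' L}
  supercharacters_eq : S.supercharacters =
    {χ | ∃ ξ ∈ V.supercharacters, χ = fun g : G => ξ (g : G ⧸ N)} ∪
    {χ | ∃ ψ ∈ U.supercharacters, ψ ≠ 1 ∧ χ = induced N ψ}

/-- `S` is a `∗`-product over the subgroup `N`. -/
def IsStarProductOver (S : SupercharacterTheory G) (N : Subgroup G) : Prop :=
  ∃ (U : SupercharacterTheory N) (V : SupercharacterTheory (G ⧸ N)), S.IsStarProduct N U V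

/-- `U` is the restriction `S_N` of `S` to `N`: the superclasses are the superclasses of `S`
contained in `N`, and the supercharacters are, up to nonzero constants, the restrictions to `N`
of the supercharacters of `S`. -/
structure IsRestriction (S : SupercharacterTheory G) (N : Subgroup G)
    (U : SupercharacterTheory N) : Prop where
  isUnion : ∀ K ∈ S.classes, (K ∩ (N : Set G)).Nonempty → K ⊆ N
  classes_eq : U.classes = {L | (fun x : N => (x : G)) '' L ∈ S.classes}
  restrict_mem : ∀ χ ∈ S.supercharacters, ∃ ψ ∈ U.supercharacters, ∃ c : ℂ, c ≠ 0 ∧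
    ∀ x : N, χ x = c * ψ x
  exists_restrict : ∀ ψ ∈ U.supercharacters, ∃ χ ∈ S.supercharacters, ∃ c : ℂ, c ≠ 0 ∧
    ∀ x : N, χ x = c * ψ x

/-- `G` is the internal direct product of `H` and `N`, and `S` is the direct product `E × F` of
the supercharacter theories `E` of `H` and `F` of `N`. -/
structure IsDirectProduct (S : SupercharacterTheory G) (H N : Subgroup G)
    (E : SupercharacterTheory H) (F : SupercharacterTheory N) : Prop where
  isComplement : Subgroup.IsComplement' H N
  classes_eq : S.classes = {M | ∃ K ∈ E.classes, ∃ L ∈ F.classes,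
    M = {x | ∃ h ∈ K, ∃ k ∈ L, x = (h : G) * (k : G)}}
  supercharacters_eq : S.supercharacters = {θ | ∃ χ ∈ E.supercharacters,
    ∃ ξ ∈ F.supercharacters, ∀ (h : H) (k : N), θ ((h : G) * (k : G)) = χ h * ξ k}

/-- `S` is a direct product over `H` and `N`: it is `S_H × S_N`. -/
def IsDirectProductOver (S : SupercharacterTheory G) (H N : Subgroup G) : Prop :=
  ∃ (E : SupercharacterTheory H) (F : SupercharacterTheory N),
    S.IsRestriction H E ∧ S.IsRestriction N F ∧ S.IsDirectProduct H N E F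

/-- `S` comes from the group `A` of automorphisms: the superclasses and the parts of the set of
irreducible characters are the orbits of `A`, with action `χ^a(g) = χ(a⁻¹ g)` on characters. -/
structure ComesFrom (S : SupercharacterTheory G) (A : Subgroup (MulAut G)) : Prop where
  classes_eq : S.classes = {K | ∃ g : G, K = {x | ∃ a ∈ A, x = a g}}
  charParts_eq : S.charParts = {X | ∃ χ : G →* ℂˣ,
    X = {ψ | ∃ a ∈ A, ∀ g : G, ψ g = χ (a⁻¹ g)}}

/-- `S` comes from automorphisms. -/
def ComesFromAutomorphisms (S : SupercharacterTheory G) : Prop :=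
  ∃ A : Subgroup (MulAut G), S.ComesFrom A

end Definitions

end SupercharacterTheory

/-!
Write `g ~ h` for elements in the same superclass, and likewise for characters in the same part
(`classRel`, `charRel`). By `forall_classRel_iff_forall_charRel`, a function on `G` is constant on
superclasses exactly if its Fourier coefficients are constant on parts; each of the two relations
therefore determines the other, and every symmetry of one gives a symmetry of the other. In
particular both are stable under multiplication by their singletons, and under powers coprime to the
group order, the latter by Galois conjugation of roots of unity (`classRel_pow`, `charRel_pow`).

For a relation with these symmetries on a group of order `p ^ 2` and exponent `p`, whose singletons
include a subgroup `Z` of order `p`, there is a dichotomy (`Setoid.stable_or_exists_powers`). Either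
classes outside `Z` are unions of cosets of `Z`, or they meet each coset of `Z` at most once. In the
second case, take `g` outside `Z` and `g ^ b * z ~ g` with `b ≢ 1` modulo `p`: multiplying `g` by
the `(b - 1)`-th root of `z` in `Z` gives `h` with `h ^ b ~ h`, and comparing `b`-th powers with
translates shows that the class of `h` consists of powers of `h`.

If `Z(S)` has order `p`, the dichotomy for `classRel` gives a `∗`-product over `Z(S)` or the direct
product of `Z(S)` and `⟨h⟩ = [G, S]`. If `Z(S)` is trivial and `[G, S]` is proper, the characters
trivial on `[G, S]` are singletons of `charRel` and form a group of order `p`. The second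
alternative for `charRel` would put the kernel of a character into `Z(S)`, so the first holds, which says that
the superclasses outside `[G, S]` are its cosets: a `∗`-product over `[G, S]`. If `Z(S) = G`, then
`[G, S]` is trivial and `S` is a `∗`-product over it.

The factors of these products are theories whose classes are orbits of power maps (`powTheory`).
Products are recognized by their superclasses alone (`isStarProduct_of_classRel`,
`isDirectProductOver_of_classRel`), and so is the origin from automorphisms
(`comesFrom_of_classRel`). For the latter, automorphisms fixing a subgroup of order `p` pointwise
and moving one element outside it to another (`exists_mulAut_apply_eq`) suffice.
-/

/-! ### Superclass functions and their coefficients -/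

theorem Nat.Coprime.exists_coprime_mul_modEq_one {m n : ℕ} (h : m.Coprime n) (hn : n ≠ 0) :
    ∃ k : ℕ, k.Coprime n ∧ m * k ≡ 1 [MOD n] := by
  have : NeZero n := ⟨hn⟩
  refine ⟨((ZMod.unitOfCoprime m h)⁻¹ : (ZMod n)ˣ).val.val, ZMod.val_coe_unit_coprime _, ?_⟩
  rw [← ZMod.natCast_eq_natCast_iff]
  push_cast
  rw [ZMod.natCast_zmod_val, ← ZMod.coe_unitOfCoprime m h, Units.mul_inv]

theorem Nat.ModEq.pow_eq {M : Type*} [Monoid M] {x : M} {n a b : ℕ} (h : a ≡ b [MOD n])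
    (hx : x ^ n = 1) : x ^ a = x ^ b := by
  rw [pow_eq_pow_mod a hx, pow_eq_pow_mod b hx, h]

open scoped Classical in
/-- The terms of a sum collected according to the classes of an equivalence relation. -/
theorem Setoid.sum_mul_eq {α : Type*} [Fintype α] (r : Setoid α) {f : α → ℂ}
    (hf : ∀ x y, r x y → f x = f y) (u : α → ℂ) :
    ∑ x, f x * u x = ∑ q : Quotient r, f q.out * ∑ x with r q.out x, u x := by
  rw [← Finset.sum_fiberwise (g := fun x => (Quotient.mk r x))]
  refine Finset.sum_congr rfl fun q _ => ?_
  rw [Finset.mul_sum]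
  have hq : ∀ x, Quotient.mk r x = q ↔ r q.out x := fun x => by
    conv_lhs => rw [← q.out_eq, eq_comm]
    exact Quotient.eq
  simp_rw [hq]
  exact Finset.sum_congr rfl fun x hx => by rw [hf _ _ (Finset.mem_filter.1 hx).2]

namespace SupercharacterTheory

section Relations

variable {G : Type*} [CommGroup G] [Finite G]

/-- The equivalence relation on `G` whose classes are the superclasses of `S`. -/
def classRel (S : SupercharacterTheory G) : Setoid G :=
  Setoid.mkClasses S.classes S.isPartition_classes.2

/-- The equivalence relation on the irreducible characters whose classes are the parts of the
partition of the irreducible characters given by `S`. -/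
def charRel (S : SupercharacterTheory G) : Setoid (G →* ℂˣ) :=
  Setoid.mkClasses S.charParts S.isPartition_charParts.2

theorem classes_classRel (S : SupercharacterTheory G) : S.classRel.classes = S.classes :=
  Setoid.classes_mkClasses _ S.isPartition_classes

theorem classes_charRel (S : SupercharacterTheory G) : S.charRel.classes = S.charParts :=
  Setoid.classes_mkClasses _ S.isPartition_charParts

theorem classRel_iff (S : SupercharacterTheory G) {g h : G} :
    S.classRel g h ↔ ∃ K ∈ S.classes, g ∈ K ∧ h ∈ K := by
  rw [Setoid.rel_iff_exists_classes, classes_classRel]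

theorem charRel_iff (S : SupercharacterTheory G) {ψ φ : G →* ℂˣ} :
    S.charRel ψ φ ↔ ∃ X ∈ S.charParts, ψ ∈ X ∧ φ ∈ X := by
  rw [Setoid.rel_iff_exists_classes, classes_charRel]

theorem mem_classes_iff (S : SupercharacterTheory G) {K : Set G} :
    K ∈ S.classes ↔ ∃ g, K = {x | S.classRel x g} := by
  rw [← classes_classRel]; rfl

theorem mem_charParts_iff (S : SupercharacterTheory G) {X : Set (G →* ℂˣ)} :
    X ∈ S.charParts ↔ ∃ χ, X = {ψ | S.charRel ψ χ} := by
  rw [← classes_charRel]; rfl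

theorem singleton_mem_charParts_iff (S : SupercharacterTheory G) {χ : G →* ℂˣ} :
    {χ} ∈ S.charParts ↔ ∀ ψ, S.charRel χ ψ → ψ = χ := by
  rw [mem_charParts_iff]
  constructor
  · rintro ⟨φ, hφ⟩ ψ hψ
    have h1 : χ ∈ {ψ | S.charRel ψ φ} := hφ ▸ rfl
    have h2 : ψ ∈ ({χ} : Set (G →* ℂˣ)) := by
      rw [hφ]; exact S.charRel.trans (S.charRel.symm hψ) h1
    exact h2
  · intro h
    refine ⟨χ, ?_⟩
    ext ψ
    refine ⟨?_, fun hψ => h ψ (S.charRel.symm hψ)⟩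
    rintro rfl
    exact S.charRel.refl _

theorem mem_center_iff (S : SupercharacterTheory G) {z : G} :
    z ∈ S.center ↔ ∀ x, S.classRel z x → x = z := by
  change {z} ∈ S.classes ↔ _
  rw [mem_classes_iff]
  constructor
  · rintro ⟨y, hy⟩ x hx
    have h1 : z ∈ {x | S.classRel x y} := hy ▸ rfl
    have h2 : x ∈ ({z} : Set G) := by
      rw [hy]; exact S.classRel.trans (S.classRel.symm hx) h1
    exact h2
  · intro h
    refine ⟨z, ?_⟩
    ext x
    refine ⟨?_, fun hx => h x (S.classRel.symm hx)⟩
    rintro rfl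
    exact S.classRel.refl _

theorem apply_eq_of_mem_center (S : SupercharacterTheory G) {z : G} (hz : z ∈ S.center)
    {ψ φ : G →* ℂˣ} (h : S.charRel ψ φ) : ψ z = φ z := by
  obtain ⟨X, hX, h1, h2⟩ := S.charRel_iff.1 h
  exact (S.singleton_mem_classes_iff z).1 hz X hX ψ h1 φ h2

theorem mem_center_of_forall (S : SupercharacterTheory G) {z : G}
    (h : ∀ ψ φ, S.charRel ψ φ → ψ z = φ z) : z ∈ S.center :=
  (S.singleton_mem_classes_iff z).2 fun X hX ψ hψ φ hφ => h ψ φ (S.charRel_iff.2 ⟨X, hX, hψ, hφ⟩)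

/-- Fourier inversion on a finite abelian group. -/
theorem eq_sum_char [Fintype G] [Fintype (G →* ℂˣ)] (f : G → ℂ) (x : G) :
    f x = ∑ ψ : G →* ℂˣ, ((Nat.card G : ℂ)⁻¹ * ∑ g, f g * ((ψ g)⁻¹ : ℂ)) * (ψ x : ℂ) := by
  classical
  have hG : (Nat.card G : ℂ) ≠ 0 := by exact_mod_cast Nat.card_pos.ne'
  simp_rw [Finset.mul_sum, Finset.sum_mul]
  rw [Finset.sum_comm]
  have key : ∀ g : G, ∑ ψ : G →* ℂˣ, (Nat.card G : ℂ)⁻¹ * (f g * ((ψ g)⁻¹ : ℂ)) * (ψ x : ℂ) =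
      (Nat.card G : ℂ)⁻¹ * f g * if x = g then (Nat.card G : ℂ) else 0 := by
    intro g
    rw [← sum_char_mul, Finset.mul_sum]
    exact Finset.sum_congr rfl fun ψ _ => by ring
  simp_rw [key]
  simp only [mul_ite, mul_zero, Finset.sum_ite_eq, Finset.mem_univ, if_true]
  field_simp

/-- The superclass functions are exactly the combinations of characters whose coefficients are
constant on the parts of the partition of the characters. This is the form in which the axioms of
a supercharacter theory are used below. -/
theorem forall_classRel_iff_forall_charRel (S : SupercharacterTheory G) [Fintype (G →* ℂˣ)]
    (a : (G →* ℂˣ) → ℂ) :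
    (∀ g h, S.classRel g h → ∑ ψ, a ψ * (ψ g : ℂ) = ∑ ψ, a ψ * (ψ h : ℂ)) ↔
      ∀ ψ φ, S.charRel ψ φ → a ψ = a φ := by
  classical
  have : Fintype S.charParts := Fintype.ofFinite _
  obtain ⟨n, h0, hn, hc⟩ := S.exists_multiplicity
  -- The multiplicities are constant on parts, as seen from the regular character.
  obtain ⟨d, hd⟩ : ∃ d : S.charParts → ℂ,
      ∀ X : S.charParts, ∀ ψ ∈ (X : Set (G →* ℂˣ)), 1 = d X * (n X ψ : ℂ) := by
    obtain ⟨d, hd⟩ := S.exists_coeff h0 hn hc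
      (fun x => if x = 1 then (Nat.card G : ℂ) else 0) (by
        intro K hK a ha b hb
        have h1 : ∀ c : G, c ∈ K → (c = 1 ↔ K = {1}) := fun c hcK => by
          constructor
          · rintro rfl
            exact (S.isPartition_classes.2 1).unique ⟨hK, hcK⟩ ⟨S.singleton_one_mem, rfl⟩
          · rintro rfl
            exact hcK
        simp only [h1 a ha, h1 b hb])
    have := coeff_ext (fun ψ : G →* ℂˣ => ((ψ 1)⁻¹ : ℂ)) _ (fun x => by
      rw [← hd x]; exact sum_char_mul 1 x)
    refine ⟨d, fun X ψ hψ => ?_⟩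
    rw [← S.sum_charParts hn d X ψ hψ]
    simpa using congrFun this ψ
  have hconst : ∀ X : S.charParts, ∀ ψ ∈ (X : Set (G →* ℂˣ)), ∀ φ ∈ (X : Set (G →* ℂˣ)),
      (n X ψ : ℂ) = n X φ := fun X ψ hψ φ hφ => by
    have h1 := hd X ψ hψ
    have hne : d X ≠ 0 := fun e => by simp [e] at h1
    exact mul_left_cancel₀ hne (h1.symm.trans (hd X φ hφ))
  constructor
  · intro H ψ φ hψφ
    obtain ⟨X, hX, h1, h2⟩ := S.charRel_iff.1 hψφ
    obtain ⟨c, hcc⟩ := S.exists_coeff h0 hn hc (fun x => ∑ ψ, a ψ * (ψ x : ℂ))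
      (fun K hK g hg h hh => H g h (S.classRel_iff.2 ⟨K, hK, hg, hh⟩))
    have e := coeff_ext a _ hcc
    rw [e]
    beta_reduce
    rw [S.sum_charParts hn c ⟨X, hX⟩ ψ h1, S.sum_charParts hn c ⟨X, hX⟩ φ h2,
      hconst ⟨X, hX⟩ ψ h1 φ h2]
  · intro H g h hgh
    obtain ⟨K, hK, hg, hh⟩ := S.classRel_iff.1 hgh
    choose r hr using fun X : S.charParts =>
      Setoid.nonempty_of_mem_partition S.isPartition_charParts X.2
    have ha : a = fun ψ => ∑ X : S.charParts, (a (r X) * d X) * (n X ψ : ℂ) := by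
      funext ψ
      obtain ⟨X, ⟨hX, hψ⟩, -⟩ := S.isPartition_charParts.2 ψ
      rw [S.sum_charParts hn _ ⟨X, hX⟩ ψ hψ, mul_assoc, ← hd ⟨X, hX⟩ ψ hψ, mul_one]
      exact H _ _ (S.charRel_iff.2 ⟨X, hX, hψ, hr ⟨X, hX⟩⟩)
    have key : ∀ x : G, ∑ ψ, a ψ * (ψ x : ℂ) =
        ∑ X : S.charParts, (a (r X) * d X) * ∑ ψ, (n X ψ : ℂ) * (ψ x : ℂ) := by
      intro x
      conv_lhs => rw [ha]
      simp_rw [Finset.sum_mul, Finset.mul_sum, mul_assoc]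
      exact Finset.sum_comm
    rw [key, key]
    exact Finset.sum_congr rfl fun X _ => by rw [hc X K hK g hg h hh]

/-- Elements with the same values under all supercharacters lie in the same superclass. -/
theorem classRel_of_forall (S : SupercharacterTheory G) [Fintype (G →* ℂˣ)] {g h : G}
    (H : ∀ a : (G →* ℂˣ) → ℂ, (∀ ψ φ, S.charRel ψ φ → a ψ = a φ) →
      ∑ ψ, a ψ * (ψ g : ℂ) = ∑ ψ, a ψ * (ψ h : ℂ)) : S.classRel g h := by
  classical
  have : Fintype G := Fintype.ofFinite G
  have ha := eq_sum_char (fun x : G => if S.classRel g x then (1 : ℂ) else 0)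
  have h1 := H _ ((S.forall_classRel_iff_forall_charRel _).1 fun x y hxy => by
    rw [← ha, ← ha]
    have : S.classRel g x ↔ S.classRel g y :=
      ⟨fun h => S.classRel.trans h hxy, fun h => S.classRel.trans h (S.classRel.symm hxy)⟩
    simp only [this])
  rw [← ha, ← ha] at h1
  rw [if_pos (S.classRel.refl g)] at h1
  by_contra hn
  simp [hn] at h1

/-- Characters with the same coefficient in every superclass function lie in the same part. -/
theorem charRel_of_forall (S : SupercharacterTheory G) [Fintype (G →* ℂˣ)] {ψ φ : G →* ℂˣ}
    (H : ∀ a : (G →* ℂˣ) → ℂ,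
      (∀ g h, S.classRel g h → ∑ ψ, a ψ * (ψ g : ℂ) = ∑ ψ, a ψ * (ψ h : ℂ)) → a ψ = a φ) :
    S.charRel ψ φ := by
  classical
  have h1 := H (fun χ => if S.charRel ψ χ then (1 : ℂ) else 0)
    ((S.forall_classRel_iff_forall_charRel _).2 fun x y hxy => by
      have : S.charRel ψ x ↔ S.charRel ψ y :=
        ⟨fun h => S.charRel.trans h hxy, fun h => S.charRel.trans h (S.charRel.symm hxy)⟩
      simp only [this])
  beta_reduce at h1
  rw [if_pos (S.charRel.refl ψ)] at h1
  by_contra hn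
  simp [hn] at h1

/-- A linear character is a part by itself if and only if it is a superclass function. -/
theorem forall_apply_eq_iff_singleton (S : SupercharacterTheory G) (χ : G →* ℂˣ) :
    (∀ g h, S.classRel g h → χ g = χ h) ↔ {χ} ∈ S.charParts := by
  classical
  have : Fintype (G →* ℂˣ) := Fintype.ofFinite _
  have h1 := S.forall_classRel_iff_forall_charRel (Pi.single χ 1)
  simp only [Pi.single_apply, ite_mul, one_mul, zero_mul, Finset.sum_ite_eq', Finset.mem_univ,
    if_true, Units.val_inj] at h1
  rw [h1, singleton_mem_charParts_iff]
  constructor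
  · intro h ψ hψ
    by_contra hn
    simpa [hn] using h χ ψ hψ
  · intro h ψ φ hψφ
    have : ψ = χ ↔ φ = χ :=
      ⟨fun e => h φ (e ▸ hψφ), fun e => h ψ (e ▸ S.charRel.symm hψφ)⟩
    simp only [this]

theorem singleton_one_mem_charParts (S : SupercharacterTheory G) :
    {(1 : G →* ℂˣ)} ∈ S.charParts :=
  (S.forall_apply_eq_iff_singleton 1).1 fun _ _ _ => rfl

theorem inv_mul_mem_commutator (S : SupercharacterTheory G) {g h : G} (hgh : S.classRel g h) :
    g⁻¹ * h ∈ S.commutator := by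
  obtain ⟨K, hK, hg, hh⟩ := S.classRel_iff.1 hgh
  exact Subgroup.subset_closure ⟨K, hK, g, hg, h, hh, rfl⟩

theorem commutator_le_iff (S : SupercharacterTheory G) {N : Subgroup G} :
    S.commutator ≤ N ↔ ∀ g h, S.classRel g h → g⁻¹ * h ∈ N := by
  refine ⟨fun h x y hxy => h (S.inv_mul_mem_commutator hxy), fun h => ?_⟩
  rw [commutator, Subgroup.closure_le]
  rintro x ⟨K, hK, g, hg, k, hk, rfl⟩
  exact h g k (S.classRel_iff.2 ⟨K, hK, hg, hk⟩)

/-- The linear characters trivial on `[G, S]` are those which form a part by themselves. -/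
theorem singleton_mem_charParts_iff_commutator (S : SupercharacterTheory G) (χ : G →* ℂˣ) :
    {χ} ∈ S.charParts ↔ ∀ x ∈ S.commutator, χ x = 1 := by
  rw [← forall_apply_eq_iff_singleton]
  have h1 := S.commutator_le_iff (N := χ.ker)
  rw [SetLike.le_def] at h1
  simp only [MonoidHom.mem_ker] at h1
  rw [h1]
  simp only [map_mul, map_inv, inv_mul_eq_one]

/-! ### Symmetries of the two partitions -/

section Closure

/-- Multiplication by an element of `Z(S)` permutes the superclasses. -/
theorem classRel_mul_left (S : SupercharacterTheory G) {z g h : G} (hz : z ∈ S.center)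
    (hgh : S.classRel g h) : S.classRel (z * g) (z * h) := by
  have : Fintype (G →* ℂˣ) := Fintype.ofFinite _
  refine S.classRel_of_forall fun a ha => ?_
  have := (S.forall_classRel_iff_forall_charRel (fun ψ => a ψ * (ψ z : ℂ))).2
    (fun ψ φ h => by rw [ha ψ φ h, S.apply_eq_of_mem_center hz h]) g h hgh
  simpa [mul_assoc] using this

/-- Multiplication by a linear supercharacter permutes the parts of the partition of the
characters. -/
theorem charRel_mul_left (S : SupercharacterTheory G) {l ψ φ : G →* ℂˣ}
    (hl : {l} ∈ S.charParts) (h : S.charRel ψ φ) : S.charRel (l * ψ) (l * φ) := by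
  have : Fintype (G →* ℂˣ) := Fintype.ofFinite _
  rw [← forall_apply_eq_iff_singleton] at hl
  refine S.charRel_of_forall fun a ha => ?_
  refine (S.forall_classRel_iff_forall_charRel (fun ψ => a (l * ψ))).1 (fun x y hxy => ?_) ψ φ h
  have key : ∀ x : G, ∑ ψ, a (l * ψ) * (ψ x : ℂ) = ((l x)⁻¹ : ℂ) * ∑ ψ, a ψ * (ψ x : ℂ) := by
    intro x
    rw [← Equiv.sum_comp (Equiv.mulLeft l) (fun ψ => a ψ * (ψ x : ℂ)), Finset.mul_sum]
    refine Finset.sum_congr rfl fun ψ _ => ?_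
    have : (l x : ℂ) ≠ 0 := (l x).ne_zero
    simp only [Equiv.coe_mulLeft, MonoidHom.mul_apply, Units.val_mul]
    field_simp
  rw [key, key, ha x y hxy, hl x y hxy]

/-- A relation `∑ ζ ^ e = ∑ ζ ^ e'` between sums of roots of unity is preserved by raising the
roots of unity to a power coprime to their order, as cyclotomic polynomials are irreducible. -/
theorem _root_.IsPrimitiveRoot.sum_pow_eq_of_coprime {ι : Type*} {ζ : ℂ} {n m : ℕ}
    (hζ : IsPrimitiveRoot ζ n) (hm : m.Coprime n) (s : Finset ι) (e e' : ι → ℕ)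
    (h : ∑ i ∈ s, ζ ^ e i = ∑ i ∈ s, ζ ^ e' i) :
    ∑ i ∈ s, (ζ ^ m) ^ e i = ∑ i ∈ s, (ζ ^ m) ^ e' i := by
  have h1 : Polynomial.aeval ζ
      (∑ i ∈ s, (Polynomial.X ^ e i - Polynomial.X ^ e' i) : Polynomial ℤ) = 0 := by
    simp [Finset.sum_sub_distrib, h]
  rcases Nat.eq_zero_or_pos n with rfl | hn
  · obtain rfl : m = 1 := by simpa using hm
    simpa using h
  · have h2 := minpoly.isIntegrallyClosed_dvd (hζ.isIntegral hn) h1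
    rw [hζ.minpoly_eq_pow_coprime hm] at h2
    have h3 := Polynomial.aeval_eq_zero_of_dvd_aeval_eq_zero h2 (minpoly.aeval _ _)
    simpa [Finset.sum_sub_distrib, sub_eq_zero] using h3

/-- Raising to a power coprime to the group order permutes the superclasses. -/
theorem classRel_pow (S : SupercharacterTheory G) {m : ℕ} (hm : m.Coprime (Nat.card G)) {g h : G}
    (hgh : S.classRel g h) : S.classRel (g ^ m) (h ^ m) := by
  classical
  have : Fintype (G →* ℂˣ) := Fintype.ofFinite _
  have hcard : (Nat.card G) ≠ 0 := Nat.card_pos.ne'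
  have : NeZero (Nat.card G) := ⟨hcard⟩
  set ζ := Complex.exp (2 * Real.pi * Complex.I / Nat.card G) with hζ
  have hp : IsPrimitiveRoot ζ (Nat.card G) := Complex.isPrimitiveRoot_exp _ hcard
  have hroot : ∀ (ψ : G →* ℂˣ) (x : G), ∃ e : ℕ, (ψ x : ℂ) = ζ ^ e := by
    intro ψ x
    have : (ψ x : ℂ) ^ Nat.card G = 1 := by
      rw [← Units.val_pow_eq_pow_val, ← map_pow, pow_card_eq_one', map_one, Units.val_one]
    obtain ⟨i, -, hi⟩ := hp.eq_pow_of_pow_eq_one this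
    exact ⟨i, hi.symm⟩
  choose e he using hroot
  have hsum : ∀ χ : G →* ℂˣ, ∑ ψ with S.charRel χ ψ, (ψ (g ^ m) : ℂ) =
      ∑ ψ with S.charRel χ ψ, (ψ (h ^ m) : ℂ) := by
    intro χ
    have h1 := (S.forall_classRel_iff_forall_charRel
      (fun ψ => if S.charRel χ ψ then (1 : ℂ) else 0)).2 (fun x y hxy => by
        have : S.charRel χ x ↔ S.charRel χ y :=
          ⟨fun h => S.charRel.trans h hxy, fun h => S.charRel.trans h (S.charRel.symm hxy)⟩
        simp only [this]) g h hgh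
    simp only [ite_mul, one_mul, zero_mul, ← Finset.sum_filter] at h1
    simp_rw [he _ g, he _ h] at h1
    have h2 := hp.sum_pow_eq_of_coprime hm _ _ _ h1
    simp_rw [← pow_mul, mul_comm m, pow_mul, ← he] at h2
    simpa using h2
  refine S.classRel_of_forall fun a ha => ?_
  rw [S.charRel.sum_mul_eq ha, S.charRel.sum_mul_eq ha]
  simp_rw [hsum]

/-- Raising to a power coprime to the group order permutes the parts of the partition of the
characters. -/
theorem charRel_pow (S : SupercharacterTheory G) {m : ℕ} (hm : m.Coprime (Nat.card G))
    {ψ φ : G →* ℂˣ} (h : S.charRel ψ φ) : S.charRel (ψ ^ m) (φ ^ m) := by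
  have : Fintype (G →* ℂˣ) := Fintype.ofFinite _
  have hm' : (Nat.card (G →* ℂˣ)).Coprime m := by
    rw [CommGroup.card_monoidHom_of_hasEnoughRootsOfUnity]; exact hm.symm
  refine S.charRel_of_forall fun a ha => ?_
  refine (S.forall_classRel_iff_forall_charRel (fun ψ => a (ψ ^ m))).1 (fun x y hxy => ?_) ψ φ h
  -- Reindex the sum over characters by the bijection `ψ ↦ ψ ^ m`.
  have key : ∀ x : G, ∑ ψ, a (ψ ^ m) * (ψ (x ^ m) : ℂ) = ∑ ψ, a ψ * (ψ x : ℂ) := by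
    intro x
    rw [← Equiv.sum_comp (powCoprime hm') (fun ψ => a ψ * (ψ x : ℂ))]
    simp [powCoprime]
  obtain ⟨k, hk, hkc⟩ : ∃ k : ℕ, (∀ x : G, (x ^ k) ^ m = x) ∧ k.Coprime (Nat.card G) := by
    obtain ⟨k, hk, hmk⟩ := hm.exists_coprime_mul_modEq_one Nat.card_pos.ne'
    refine ⟨k, fun x => ?_, hk⟩
    rw [← pow_mul, mul_comm, hmk.pow_eq (pow_card_eq_one' (x := x)), pow_one]
  rw [← hk x, ← hk y, key, key]
  exact ha _ _ (S.classRel_pow hkc hxy)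

end Closure

end Relations

end SupercharacterTheory

/-! ### Subgroups of index `p` in groups of exponent `p` -/

section ElementaryAbelian

variable {P : Type*} [CommGroup P] {p : ℕ} [Fact p.Prime]

theorem Subgroup.exists_eq_pow_mul {Z : Subgroup P} (hI : Nat.card (P ⧸ Z) = p) {g : P}
    (hg : g ∉ Z) (x : P) : ∃ m : ℕ, ∃ z ∈ Z, x = g ^ m * z := by
  have h1 : (g : P ⧸ Z) ≠ 1 := fun h => hg ((QuotientGroup.eq_one_iff g).1 h)
  obtain ⟨m, hm⟩ := mem_powers_of_prime_card hI h1 (g' := (x : P ⧸ Z))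
  refine ⟨m, (g ^ m)⁻¹ * x, ?_, by simp⟩
  rw [← QuotientGroup.eq]
  simpa using hm

theorem Subgroup.exists_eq_pow_of_card {Z : Subgroup P} (hZ : Nat.card Z = p) {z w : P}
    (hz : z ∈ Z) (hw : w ∈ Z) (h1 : z ≠ 1) : ∃ m : ℕ, w = z ^ m := by
  obtain ⟨m, hm⟩ := mem_powers_of_prime_card hZ (g := (⟨z, hz⟩ : Z)) (g' := ⟨w, hw⟩)
    (fun h => h1 (congrArg Subtype.val h))
  exact ⟨m, by simpa using (congrArg Subtype.val hm).symm⟩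

theorem Subgroup.exists_notMem_of_card_quotient {N : Subgroup P}
    (hI : Nat.card (P ⧸ N) = p) : ∃ g, g ∉ N := by
  by_contra! h
  obtain rfl : N = ⊤ := (Subgroup.eq_top_iff' N).2 h
  have : Nat.card (P ⧸ (⊤ : Subgroup P)) = 1 := Subgroup.index_top
  exact (Fact.out : p.Prime).one_lt.ne' (hI.symm.trans this)

theorem coprime_of_pow_mul_notMem (hexp : ∀ x : P, x ^ p = 1) {Z : Subgroup P} {g z : P} {m : ℕ}
    (hz : z ∈ Z) (h : g ^ m * z ∉ Z) : m.Coprime p := by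
  rw [Nat.coprime_comm, (Fact.out : p.Prime).coprime_iff_not_dvd]
  rintro ⟨k, rfl⟩
  exact h (by rwa [pow_mul, hexp, one_pow, one_mul])

theorem pow_notMem_of_coprime (hexp : ∀ x : P, x ^ p = 1) {Z : Subgroup P} {g : P} {m : ℕ}
    (hm : m.Coprime p) (hg : g ∉ Z) : g ^ m ∉ Z := by
  intro h
  obtain ⟨k, -, hk⟩ := hm.exists_coprime_mul_modEq_one (Fact.out : p.Prime).ne_zero
  have := Z.pow_mem h k
  rw [← pow_mul, hk.pow_eq (hexp g), pow_one] at this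
  exact hg this

/-- The dichotomy behind the theorem. Let `Z` have order and index `p` in a group of exponent `p`,
and let `r` be an equivalence relation for which the elements of `Z` are related to themselves
only, and which is stable under multiplication by elements of `Z` and under powers coprime to `p`.
Then either the classes outside `Z` are unions of cosets of `Z`, or some class outside `Z` consists
of powers of one element. -/
theorem Setoid.stable_or_exists_powers (hexp : ∀ x : P, x ^ p = 1) {Z : Subgroup P}
    (hZ : Nat.card Z = p) (hI : Nat.card (P ⧸ Z) = p) (r : Setoid P)
    (hsing : ∀ z ∈ Z, ∀ x, r z x → x = z)
    (hmul : ∀ z ∈ Z, ∀ x y, r x y → r (z * x) (z * y))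
    (hpow : ∀ m : ℕ, m.Coprime p → ∀ x y, r x y → r (x ^ m) (y ^ m)) :
    (∀ g, g ∉ Z → ∀ z ∈ Z, r g (g * z)) ∨ ∃ h, h ∉ Z ∧ ∀ x, r h x → ∃ m : ℕ, x = h ^ m := by
  have hp : p.Prime := Fact.out
  by_cases hA : ∃ g, g ∉ Z ∧ ∃ z ∈ Z, z ≠ 1 ∧ r g (g * z)
  · left
    obtain ⟨g, hg, z, hz, hz1, hgz⟩ := hA
    have h1 : ∀ j : ℕ, r g (g * z ^ j) := by
      intro j
      induction j with
      | zero => simp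
      | succ j ih =>
        refine r.trans ih ?_
        have := hmul _ (Z.pow_mem hz j) _ _ hgz
        rwa [mul_comm, mul_left_comm, mul_comm (z ^ j), ← pow_succ'] at this
    intro g' hg' z' hz'
    obtain ⟨m, w, hw, rfl⟩ := Subgroup.exists_eq_pow_mul hI hg g'
    have hm := coprime_of_pow_mul_notMem hexp hw hg'
    obtain ⟨k, -, hk⟩ := hm.exists_coprime_mul_modEq_one hp.ne_zero
    obtain ⟨j, hj⟩ := Subgroup.exists_eq_pow_of_card hZ hz (Z.pow_mem hz' k) hz1
    have h2 := hmul w hw _ _ (hpow m hm _ _ (h1 j))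
    rw [← hj, mul_pow, ← pow_mul, mul_comm k, hk.pow_eq (hexp z'), pow_one] at h2
    rwa [mul_comm _ w, mul_assoc]
  · right
    have hB : ∀ g, g ∉ Z → ∀ z ∈ Z, r g (g * z) → z = 1 := fun g hg z hz h => by
      by_contra h1
      exact hA ⟨g, hg, z, hz, h1, h⟩
    have hout : ∀ g, g ∉ Z → ∀ x, r g x → x ∉ Z := fun g hg x hx hxZ =>
      hg (hsing x hxZ g (r.symm hx) ▸ hxZ)
    obtain ⟨g, hg⟩ := Subgroup.exists_notMem_of_card_quotient hI
    by_cases hs : ∀ x, r g x → x = g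
    · exact ⟨g, hg, fun x hx => ⟨1, by rw [pow_one, hs x hx]⟩⟩
    push Not at hs
    obtain ⟨x, hgx, hxg⟩ := hs
    obtain ⟨b, z, hz, rfl⟩ := Subgroup.exists_eq_pow_mul hI hg x
    have hb := coprime_of_pow_mul_notMem hexp hz (hout g hg _ hgx)
    -- The exponent `d` stands for `b - 1`, which is invertible modulo `p`.
    obtain ⟨d, hd⟩ : ∃ d : ℕ, b ≡ d + 1 [MOD p] :=
      ⟨b + (p - 1), by
        have : b + (p - 1) + 1 = b + p := by have := hp.pos; omega
        rw [this]; simp [Nat.ModEq]⟩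
    have hbd : ∀ x : P, x ^ b = x ^ d * x := fun x => by rw [hd.pow_eq (hexp x), pow_succ]
    have hdp : d.Coprime p := by
      rw [Nat.coprime_comm, hp.coprime_iff_not_dvd]
      rintro ⟨k, rfl⟩
      have e : g ^ b = g := by rw [hbd, pow_mul, hexp, one_pow, one_mul]
      rw [e] at hgx hxg
      exact hxg (by rw [hB g hg z hz hgx, mul_one])
    obtain ⟨k, -, hk⟩ := hdp.exists_coprime_mul_modEq_one hp.ne_zero
    -- Translating `g` by the `(b - 1)`-th root `c` of `z` removes the component in `Z`.
    set c := z ^ k with hc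
    have hcZ : c ∈ Z := Z.pow_mem hz k
    have hcd : c ^ d = z := by rw [hc, ← pow_mul, mul_comm, hk.pow_eq (hexp z), pow_one]
    have hh : g * c ∉ Z := fun h => hg ((Z.mul_mem_cancel_right hcZ).1 h)
    have hhb : r (g * c) ((g * c) ^ b) := by
      have := hmul c hcZ _ _ hgx
      rwa [mul_comm c g, mul_comm c, mul_assoc, ← hcd, ← hbd, ← mul_pow] at this
    generalize g * c = h at hh hhb
    refine ⟨h, hh, fun y hy => ?_⟩
    obtain ⟨a, w, hw, rfl⟩ := Subgroup.exists_eq_pow_mul hI hh y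
    have hyZ := hout h hh _ hy
    have ha := coprime_of_pow_mul_notMem hexp hw hyZ
    have e1 : r (h ^ a * w) ((h ^ a * w) ^ b) :=
      r.trans (r.symm hy) (r.trans hhb (hpow b hb _ _ hy))
    have e2 := hmul w hw _ _ (hpow a ha _ _ hhb)
    have e3 : r ((h ^ a * w) ^ b) ((h ^ a * w) ^ b * (w ^ d)⁻¹) := by
      refine r.trans (r.symm e1) ?_
      rw [mul_comm w, mul_comm w] at e2
      have : (h ^ a * w) ^ b * (w ^ d)⁻¹ = (h ^ b) ^ a * w := by
        rw [mul_pow, hbd w, ← pow_mul, ← pow_mul, mul_comm a b, mul_assoc, mul_comm _ w, mul_assoc,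
          mul_inv_cancel, mul_one]
      rwa [this]
    have e4 := hB _ (pow_notMem_of_coprime hexp hb hyZ) _ (Z.inv_mem (Z.pow_mem hw d)) e3
    have e5 : w = 1 := by
      have : w ^ (d * k) = 1 := by rw [pow_mul, inv_eq_one.1 e4, one_pow]
      rwa [hk.pow_eq (hexp w), pow_one] at this
    exact ⟨a, by rw [e5, mul_one]⟩

/-- In a group of exponent `p`, an element outside a subgroup of index `p` can be moved to any other
one by an automorphism fixing the subgroup pointwise. -/
theorem exists_mulAut_apply_eq [Finite P] (hexp : ∀ x : P, x ^ p = 1) {H : Subgroup P}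
    (hI : Nat.card (P ⧸ H) = p) {g k : P} (hg : g ∉ H) (hk : k ∉ H) :
    ∃ f : MulAut P, (∀ x ∈ H, f x = x) ∧ f g = k := by
  have h1 : (g : P ⧸ H) ≠ 1 := fun h => hg ((QuotientGroup.eq_one_iff g).1 h)
  have hgen : ∀ x, x ∈ Subgroup.zpowers (g : P ⧸ H) :=
    fun x => mem_zpowers_of_prime_card hI h1
  have hord : orderOf (g⁻¹ * k) ∣ orderOf (g : P ⧸ H) := by
    have : orderOf (g : P ⧸ H) = p := orderOf_eq_prime
      (by rw [← QuotientGroup.mk_pow, hexp, QuotientGroup.mk_one]) h1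
    rw [this]
    exact orderOf_dvd_of_pow_eq_one (hexp _)
  let t : P →* P := (monoidHomOfForallMemZpowers hgen hord).comp (QuotientGroup.mk' H)
  let f : P →* P :=
    { toFun := fun x => x * t x
      map_one' := by simp
      map_mul' := fun x y => by rw [map_mul]; exact mul_mul_mul_comm _ _ _ _ }
  have hfH : ∀ x ∈ H, f x = x := fun x hx => by
    have : t x = 1 := by
      simp only [t, MonoidHom.comp_apply, QuotientGroup.mk'_apply,
        (QuotientGroup.eq_one_iff x).2 hx, map_one]
    change x * t x = x
    rw [this, mul_one]
  have hfg : f g = k := by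
    have : t g = g⁻¹ * k := monoidHomOfForallMemZpowers_apply_gen hgen hord
    change g * t g = k
    rw [this, mul_inv_cancel_left]
  have hsurj : Function.Surjective f := fun x => by
    obtain ⟨m, z, hz, rfl⟩ := Subgroup.exists_eq_pow_mul hI hk x
    exact ⟨g ^ m * z, by rw [map_mul, map_pow, hfg, hfH z hz]⟩
  exact ⟨MulEquiv.ofBijective f (Finite.injective_iff_surjective.2 hsurj |>.bijective_of_finite),
    hfH, hfg⟩

end ElementaryAbelian

/-! ### Class sums, supercharacters, and automorphisms -/

open scoped Classical in
/-- A sum over a group of a function factoring through a surjective homomorphism. -/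
theorem MonoidHom.sum_comp_of_surjective {A B : Type*} [Group A] [Group B] [Fintype A] [Fintype B]
    (f : A →* B) (hf : Function.Surjective f) (u : B → ℂ) :
    ∑ a, u (f a) = (Nat.card f.ker : ℂ) * ∑ b, u b := by
  rw [← Finset.sum_fiberwise (g := f), Finset.mul_sum]
  refine Finset.sum_congr rfl fun b _ => ?_
  have h1 : ∑ a with f a = b, u (f a) = ∑ a with f a = b, u b :=
    Finset.sum_congr rfl fun a ha => by rw [(Finset.mem_filter.1 ha).2]
  have h2 : ({a | f a = b} : Finset A).card = Nat.card f.ker := by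
    rw [card_fiber_eq_of_mem_range f (hf b) (hf 1), Nat.card_eq_fintype_card, Fintype.card_subtype]
    simp only [MonoidHom.mem_ker]
  rw [h1, Finset.sum_const, h2, nsmul_eq_mul]

namespace SupercharacterTheory

section Sums

variable {G : Type*} [CommGroup G] [Finite G]

/-- The sum of the inverse values of the character `ψ` over the superclass of `g`. -/
noncomputable def classSum (S : SupercharacterTheory G) (ψ : G →* ℂˣ) (g : G) : ℂ :=
  ∑ᶠ x ∈ {x | S.classRel g x}, ((ψ x)⁻¹ : ℂ)

/-- The supercharacter of `S` attached to the part that contains `ψ`. -/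
noncomputable def superchar (S : SupercharacterTheory G) (ψ : G →* ℂˣ) (g : G) : ℂ :=
  ∑ᶠ φ ∈ {φ | S.charRel ψ φ}, (φ g : ℂ)

open scoped Classical in
theorem classSum_eq_sum (S : SupercharacterTheory G) [Fintype G] (ψ : G →* ℂˣ) (g : G) :
    S.classSum ψ g = ∑ x, if S.classRel g x then ((ψ x)⁻¹ : ℂ) else 0 := by
  rw [classSum, finsum_mem_eq_finite_toFinset_sum _ (Set.toFinite _), ← Finset.sum_filter]
  refine Finset.sum_congr ?_ fun _ _ => rfl
  ext; simp

open scoped Classical in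
theorem superchar_eq_sum (S : SupercharacterTheory G) [Fintype (G →* ℂˣ)] (ψ : G →* ℂˣ) (g : G) :
    S.superchar ψ g = ∑ φ : G →* ℂˣ, if S.charRel ψ φ then (φ g : ℂ) else 0 := by
  rw [superchar, finsum_mem_eq_finite_toFinset_sum _ (Set.toFinite _), ← Finset.sum_filter]
  refine Finset.sum_congr ?_ fun _ _ => rfl
  ext; simp

theorem supercharacters_eq_range (S : SupercharacterTheory G) :
    S.supercharacters = Set.range S.superchar := by
  have hsym : ∀ χ, {ψ | S.charRel ψ χ} = {ψ | S.charRel χ ψ} := fun χ => by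
    ext ψ; exact S.charRel.comm'
  ext f
  constructor
  · rintro ⟨X, hX, rfl⟩
    obtain ⟨χ, rfl⟩ := S.mem_charParts_iff.1 hX
    refine ⟨χ, ?_⟩
    rw [hsym]
    rfl
  · rintro ⟨χ, rfl⟩
    refine ⟨{ψ | S.charRel ψ χ}, S.mem_charParts_iff.2 ⟨χ, rfl⟩, ?_⟩
    rw [hsym]
    rfl

theorem classSum_one (S : SupercharacterTheory G) (ψ : G →* ℂˣ) : S.classSum ψ 1 = 1 := by
  have : {x | S.classRel 1 x} = {1} := by
    ext x
    refine ⟨fun hx => (S.mem_center_iff.1 S.center.one_mem) x hx, ?_⟩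
    rintro rfl
    exact S.classRel.refl _
  rw [classSum, this, finsum_mem_singleton]
  simp

/-- Two characters lie in the same part if and only if all their class sums agree. -/
theorem charRel_iff_classSum (S : SupercharacterTheory G) {ψ φ : G →* ℂˣ} :
    S.charRel ψ φ ↔ ∀ g, S.classSum ψ g = S.classSum φ g := by
  classical
  have : Fintype G := Fintype.ofFinite _
  have : Fintype (G →* ℂˣ) := Fintype.ofFinite _
  have hG : (Nat.card G : ℂ)⁻¹ ≠ 0 := inv_ne_zero (by exact_mod_cast Nat.card_pos.ne')
  simp_rw [classSum_eq_sum]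
  constructor
  · intro h g
    have h1 := eq_sum_char (fun x => if S.classRel g x then (1 : ℂ) else 0)
    have h2 := (S.forall_classRel_iff_forall_charRel _).1 (fun x y hxy => by
      rw [← h1, ← h1]
      have : S.classRel g x ↔ S.classRel g y :=
        ⟨fun h => S.classRel.trans h hxy, fun h => S.classRel.trans h (S.classRel.symm hxy)⟩
      simp only [this]) ψ φ h
    simpa [hG] using h2
  · intro H
    refine S.charRel_of_forall fun a ha => ?_
    have h1 := coeff_ext a _ (eq_sum_char (fun x => ∑ ψ, a ψ * (ψ x : ℂ)))
    rw [h1]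
    beta_reduce
    rw [S.classRel.sum_mul_eq ha, S.classRel.sum_mul_eq ha]
    simp_rw [Finset.sum_filter, H]

theorem superchar_eq_one_iff (S : SupercharacterTheory G) {ψ : G →* ℂˣ} :
    S.superchar ψ = 1 ↔ ψ = 1 := by
  classical
  have : Fintype (G →* ℂˣ) := Fintype.ofFinite _
  constructor
  · intro h
    have h1 := coeff_ext (fun φ => if S.charRel ψ φ then (1 : ℂ) else 0) (Pi.single 1 1)
      (fun x => by
        have := congrFun h x
        rw [superchar_eq_sum] at this
        simpa [Pi.single_apply] using this)
    have h2 := congrFun h1 ψ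
    rw [if_pos (S.charRel.refl ψ)] at h2
    by_contra hn
    simp [hn] at h2
  · rintro rfl
    have : {φ | S.charRel 1 φ} = {1} := by
      ext x
      refine ⟨fun hx => S.singleton_mem_charParts_iff.1 S.singleton_one_mem_charParts x hx, ?_⟩
      rintro rfl
      exact S.charRel.refl _
    funext g
    rw [superchar, this, finsum_mem_singleton]
    simp

/-- A supercharacter has degree one if and only if it is a linear character. -/
theorem superchar_apply_one_eq_one_iff (S : SupercharacterTheory G) {ψ : G →* ℂˣ} :
    S.superchar ψ 1 = 1 ↔ {ψ} ∈ S.charParts := by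
  classical
  have : Fintype (G →* ℂˣ) := Fintype.ofFinite _
  rw [superchar_eq_sum, singleton_mem_charParts_iff]
  simp only [map_one, Units.val_one, Finset.sum_boole, Nat.cast_eq_one, Finset.card_eq_one]
  constructor
  · rintro ⟨χ, hχ⟩ φ hφ
    have h1 : ψ ∈ ({χ} : Finset (G →* ℂˣ)) := by rw [← hχ]; simp
    have h2 : φ ∈ ({χ} : Finset (G →* ℂˣ)) := by rw [← hχ]; simpa using hφ
    rw [Finset.mem_singleton.1 h1, Finset.mem_singleton.1 h2]
  · intro h
    refine ⟨ψ, ?_⟩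
    ext φ
    simp only [Finset.mem_filter_univ, Finset.mem_singleton]
    refine ⟨h φ, ?_⟩
    rintro rfl
    exact S.charRel.refl _

theorem superchar_apply_one_ne_zero (S : SupercharacterTheory G) (ψ : G →* ℂˣ) :
    S.superchar ψ 1 ≠ 0 := by
  classical
  have : Fintype (G →* ℂˣ) := Fintype.ofFinite _
  rw [superchar_eq_sum]
  simp only [map_one, Units.val_one, Finset.sum_boole, Nat.cast_ne_zero]
  exact (Finset.card_pos.2 ⟨ψ, by simp⟩).ne'

/-- A theory comes from a group of automorphisms as soon as its superclasses are the orbits. -/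
theorem comesFrom_of_classRel (S : SupercharacterTheory G) (A : Subgroup (MulAut G))
    (h : ∀ x y, S.classRel x y ↔ ∃ a ∈ A, y = a x) : S.ComesFrom A := by
  classical
  have : Fintype (G →* ℂˣ) := Fintype.ofFinite _
  have hchar : ∀ χ ψ : G →* ℂˣ, S.charRel χ ψ ↔ ∃ a ∈ A, ∀ g, ψ g = χ (a⁻¹ g) := by
    intro χ ψ
    constructor
    · -- The sum of the orbit of `χ` is a superclass function.
      intro hχψ
      let R : (G →* ℂˣ) → Prop := fun φ => ∃ a ∈ A, ∀ g, φ g = χ (a⁻¹ g)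
      have hR : ∀ a ∈ A, ∀ φ, R φ → R (φ.comp a.toMonoidHom) := by
        rintro a ha φ ⟨b, hb, hφ⟩
        refine ⟨a⁻¹ * b, A.mul_mem (A.inv_mem ha) hb, fun g => ?_⟩
        simp [hφ]
      have h1 := (S.forall_classRel_iff_forall_charRel (fun φ => if R φ then 1 else 0)).1
        (fun x y hxy => by
          obtain ⟨a, ha, rfl⟩ := (h x y).1 hxy
          let e : (G →* ℂˣ) ≃ (G →* ℂˣ) :=
            { toFun := fun φ => φ.comp a.toMonoidHom
              invFun := fun φ => φ.comp a⁻¹.toMonoidHom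
              left_inv := fun φ => by ext g; simp
              right_inv := fun φ => by ext g; simp }
          rw [← Equiv.sum_comp e]
          refine Finset.sum_congr rfl fun φ _ => ?_
          have h2 : R (e φ) ↔ R φ := by
            refine ⟨fun h3 => ?_, hR a ha φ⟩
            have := hR _ (A.inv_mem ha) _ h3
            rwa [show (e φ).comp (a⁻¹ : MulAut G).toMonoidHom = φ from e.left_inv φ] at this
          simp only [h2]
          rfl) χ ψ hχψ
      beta_reduce at h1
      rw [if_pos ⟨1, A.one_mem, fun g => by simp⟩] at h1
      by_contra hn
      rw [if_neg hn] at h1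
      exact one_ne_zero h1
    · rintro ⟨a, ha, hψ⟩
      rw [charRel_iff_classSum]
      intro g
      have : Fintype G := Fintype.ofFinite G
      rw [classSum_eq_sum, classSum_eq_sum, ← Equiv.sum_comp (a : G ≃* G).toEquiv
        (fun x => if S.classRel g x then ((ψ x)⁻¹ : ℂ) else 0)]
      refine Finset.sum_congr rfl fun x _ => ?_
      have h1 : S.classRel x (a x) := (h _ _).2 ⟨a, ha, rfl⟩
      have h2 : S.classRel g (a x) ↔ S.classRel g x :=
        ⟨fun h => S.classRel.trans h (S.classRel.symm h1), fun h => S.classRel.trans h h1⟩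
      simp [hψ, h2]
  constructor
  · ext K
    rw [mem_classes_iff]
    refine exists_congr fun g => ?_
    rw [show {x | S.classRel x g} = {x | ∃ a ∈ A, x = a g} from
      Set.ext fun x => S.classRel.comm'.trans (h g x)]
  · ext X
    rw [mem_charParts_iff]
    refine exists_congr fun χ => ?_
    rw [show {ψ | S.charRel ψ χ} = {ψ | ∃ a ∈ A, ∀ g, ψ g = χ (a⁻¹ g)} from
      Set.ext fun x => S.charRel.comm'.trans (hchar χ x)]

/-- A theory comes from automorphisms if related elements are always exchanged by automorphisms
that preserve each superclass. -/
theorem comesFromAutomorphisms_of_exists (S : SupercharacterTheory G)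
    (h : ∀ x y, S.classRel x y → ∃ f : MulAut G, (∀ g, S.classRel g (f g)) ∧ f x = y) :
    S.ComesFromAutomorphisms := by
  let A : Subgroup (MulAut G) :=
    { carrier := {f | ∀ g, S.classRel g (f g)}
      one_mem' := fun g => S.classRel.refl g
      mul_mem' := fun {a b} ha hb g => S.classRel.trans (hb g) (ha (b g))
      inv_mem' := fun {a} ha g => by
        have := ha (a⁻¹ g)
        rw [MulAut.apply_inv_self] at this
        exact S.classRel.symm this }
  refine ⟨A, S.comesFrom_of_classRel A fun x y => ⟨fun hxy => ?_, ?_⟩⟩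
  · obtain ⟨f, hf, rfl⟩ := h x y hxy
    exact ⟨f, hf, rfl⟩
  · rintro ⟨a, ha, rfl⟩
    exact ha x

end Sums

end SupercharacterTheory

/-! ### Recognizing `∗`-products and direct products by their superclasses -/

theorem MonoidHom.exists_comp_mk_eq {G M : Type*} [CommGroup G] [Monoid M] {N : Subgroup G}
    {ψ : G →* M} (h : ψ.domRestrict N = 1) :
    ∃ θ : (G ⧸ N) →* M, ψ = θ.comp (QuotientGroup.mk' N) :=
  ⟨QuotientGroup.lift N ψ fun x hx => MonoidHom.mem_ker.2 (DFunLike.congr_fun h ⟨x, hx⟩), by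
    ext; rfl⟩

theorem MonoidHom.domRestrict_comp_mk {G M : Type*} [CommGroup G] [Monoid M] {N : Subgroup G}
    (θ : (G ⧸ N) →* M) : (θ.comp (QuotientGroup.mk' N)).domRestrict N = 1 := by
  ext x
  have : ((x : G) : G ⧸ N) = 1 := (QuotientGroup.eq_one_iff (x : G)).2 x.2
  simp [this]

namespace SupercharacterTheory

section Products

variable {G : Type*} [CommGroup G] [Finite G]

theorem eq_one_of_classRel_one (S : SupercharacterTheory G) {x : G} (h : S.classRel 1 x) : x = 1 :=
  S.mem_center_iff.1 S.center.one_mem x h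

theorem eq_one_of_charRel_one (S : SupercharacterTheory G) {ψ : G →* ℂˣ} (h : S.charRel 1 ψ) :
    ψ = 1 :=
  S.singleton_mem_charParts_iff.1 S.singleton_one_mem_charParts ψ h

variable {S : SupercharacterTheory G} {N : Subgroup G}

section Star

variable {U : SupercharacterTheory N} {V : SupercharacterTheory (G ⧸ N)}

/-- The hypothesis `hout` here and below says that outside `N` the superclasses of `S` are the
preimages of those of `V`; together with `hin`, that inside `N` they are those of `U`, it expresses
that `S` has the superclasses of the `∗`-product of `U` and `V`. -/
theorem mem_of_classRel_of_star
    (hout : ∀ g h : G, g ∉ N → (S.classRel g h ↔ V.classRel (g : G ⧸ N) (h : G ⧸ N)))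
    {g h : G} (hgh : S.classRel g h) (hg : g ∈ N) : h ∈ N := by
  by_contra hn
  have h1 := (hout h g hn).1 (S.classRel.symm hgh)
  rw [(QuotientGroup.eq_one_iff g).2 hg] at h1
  exact hn ((QuotientGroup.eq_one_iff h).1 (V.eq_one_of_classRel_one (V.classRel.symm h1)))

theorem classes_eq_of_star
    (hin : ∀ x y : N, S.classRel x y ↔ U.classRel x y)
    (hout : ∀ g h : G, g ∉ N → (S.classRel g h ↔ V.classRel (g : G ⧸ N) (h : G ⧸ N))) :
    S.classes = {K | ∃ L ∈ U.classes, K = (fun x : N => (x : G)) '' L} ∪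
      {K | ∃ L ∈ V.classes, L ≠ {1} ∧ K = (fun g : G => (g : G ⧸ N)) ⁻¹' L} := by
  have himage : ∀ n : N, {x | S.classRel x n} = (fun x : N => (x : G)) '' {x | U.classRel x n} := by
    intro n
    ext x
    constructor
    · intro hx
      have hxN := mem_of_classRel_of_star hout (S.classRel.symm hx) n.2
      exact ⟨⟨x, hxN⟩, (hin _ _).1 hx, rfl⟩
    · rintro ⟨y, hy, rfl⟩
      exact (hin _ _).2 hy
  have hpre : ∀ g : G, g ∉ N → {x | S.classRel x g} =
      (fun g : G => (g : G ⧸ N)) ⁻¹' {x | V.classRel x g} := by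
    intro g hg
    ext x
    exact S.classRel.comm'.trans ((hout g x hg).trans V.classRel.comm')
  ext K
  rw [mem_classes_iff]
  constructor
  · rintro ⟨g, rfl⟩
    by_cases hg : g ∈ N
    · exact Or.inl ⟨_, U.mem_classes_iff.2 ⟨⟨g, hg⟩, rfl⟩, himage ⟨g, hg⟩⟩
    · refine Or.inr ⟨_, V.mem_classes_iff.2 ⟨g, rfl⟩, fun e => hg ?_, hpre g hg⟩
      have : (g : G ⧸ N) ∈ {x : G ⧸ N | V.classRel x g} := V.classRel.refl _
      rw [e] at this
      exact (QuotientGroup.eq_one_iff g).1 this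
  · rintro (⟨L, hL, rfl⟩ | ⟨L, hL, hL1, rfl⟩)
    · obtain ⟨n, rfl⟩ := U.mem_classes_iff.1 hL
      exact ⟨n, (himage n).symm⟩
    · obtain ⟨q, rfl⟩ := V.mem_classes_iff.1 hL
      obtain ⟨g, rfl⟩ := QuotientGroup.mk_surjective q
      refine ⟨g, (hpre g fun hg => hL1 ?_).symm⟩
      rw [(QuotientGroup.eq_one_iff g).2 hg]
      ext x
      refine ⟨fun hx => V.eq_one_of_classRel_one (V.classRel.symm hx), ?_⟩
      rintro rfl
      exact V.classRel.refl _

theorem classSum_of_star_of_mem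
    (hin : ∀ x y : N, S.classRel x y ↔ U.classRel x y)
    (hout : ∀ g h : G, g ∉ N → (S.classRel g h ↔ V.classRel (g : G ⧸ N) (h : G ⧸ N)))
    (ψ : G →* ℂˣ) (n : N) : S.classSum ψ n = U.classSum (ψ.domRestrict N) n := by
  have : {x | S.classRel n x} = (fun x : N => (x : G)) '' {x | U.classRel n x} := by
    ext x
    constructor
    · intro hx
      exact ⟨⟨x, mem_of_classRel_of_star hout hx n.2⟩, (hin _ _).1 hx, rfl⟩
    · rintro ⟨y, hy, rfl⟩
      exact (hin _ _).2 hy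
  rw [classSum, this, finsum_mem_image Subtype.val_injective.injOn, classSum]
  rfl

theorem classSum_comp_mk_of_star
    (hout : ∀ g h : G, g ∉ N → (S.classRel g h ↔ V.classRel (g : G ⧸ N) (h : G ⧸ N)))
    (θ : (G ⧸ N) →* ℂˣ) {g : G} (hg : g ∉ N) :
    S.classSum (θ.comp (QuotientGroup.mk' N)) g = (Nat.card N : ℂ) * V.classSum θ g := by
  classical
  have : Fintype G := Fintype.ofFinite _
  have : Fintype (G ⧸ N) := Fintype.ofFinite _
  rw [classSum_eq_sum, classSum_eq_sum]
  have := (QuotientGroup.mk' N).sum_comp_of_surjective (QuotientGroup.mk'_surjective N)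
    (fun y => if V.classRel g y then ((θ y)⁻¹ : ℂ) else 0)
  rw [QuotientGroup.ker_mk'] at this
  rw [← this]
  simp only [hout g _ hg]
  rfl

/-- Superclasses outside `N` are unions of cosets of `N`, on which a character nontrivial on `N`
sums to zero. -/
theorem classSum_eq_zero_of_star
    (hout : ∀ g h : G, g ∉ N → (S.classRel g h ↔ V.classRel (g : G ⧸ N) (h : G ⧸ N)))
    {ψ : G →* ℂˣ} (hψ : ψ.domRestrict N ≠ 1) {g : G} (hg : g ∉ N) : S.classSum ψ g = 0 := by
  classical
  have : Fintype G := Fintype.ofFinite _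
  obtain ⟨n, hn⟩ : ∃ n : N, ψ n ≠ 1 := by
    by_contra! h
    exact hψ (MonoidHom.ext h)
  have h1 : S.classSum ψ g = ((ψ n)⁻¹ : ℂ) * S.classSum ψ g := by
    rw [classSum_eq_sum, Finset.mul_sum]
    conv_lhs => rw [← Equiv.sum_comp (Equiv.mulLeft (n : G))]
    refine Finset.sum_congr rfl fun x _ => ?_
    have h2 : S.classRel g (n * x) ↔ S.classRel g x := by
      rw [hout _ _ hg, hout _ _ hg, QuotientGroup.mk_mul, (QuotientGroup.eq_one_iff (n : G)).2 n.2,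
        one_mul]
    simp only [Equiv.coe_mulLeft, h2]
    split_ifs <;> simp [mul_comm]
  have h3 : ((ψ n)⁻¹ : ℂ) ≠ 1 := fun e => hn (Units.ext (inv_eq_one.1 e))
  exact eq_zero_of_mul_eq_self_left h3 h1.symm

theorem charRel_iff_of_star_of_ne_one
    (hin : ∀ x y : N, S.classRel x y ↔ U.classRel x y)
    (hout : ∀ g h : G, g ∉ N → (S.classRel g h ↔ V.classRel (g : G ⧸ N) (h : G ⧸ N)))
    {ψ φ : G →* ℂˣ} (hψ : ψ.domRestrict N ≠ 1) :
    S.charRel ψ φ ↔ U.charRel (ψ.domRestrict N) (φ.domRestrict N) := by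
  constructor
  · intro h
    rw [charRel_iff_classSum] at h ⊢
    intro n
    rw [← classSum_of_star_of_mem hin hout, ← classSum_of_star_of_mem hin hout, h]
  · intro h
    have hφ : φ.domRestrict N ≠ 1 := fun e => by
      rw [e] at h
      exact hψ (U.eq_one_of_charRel_one (U.charRel.symm h))
    rw [charRel_iff_classSum] at h ⊢
    intro g
    by_cases hg : g ∈ N
    · have := h ⟨g, hg⟩
      rwa [← classSum_of_star_of_mem hin hout, ← classSum_of_star_of_mem hin hout] at this
    · rw [classSum_eq_zero_of_star hout hψ hg, classSum_eq_zero_of_star hout hφ hg]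

theorem charRel_comp_mk_iff_of_star
    (hin : ∀ x y : N, S.classRel x y ↔ U.classRel x y)
    (hout : ∀ g h : G, g ∉ N → (S.classRel g h ↔ V.classRel (g : G ⧸ N) (h : G ⧸ N)))
    {θ : (G ⧸ N) →* ℂˣ} {φ : G →* ℂˣ} :
    S.charRel (θ.comp (QuotientGroup.mk' N)) φ ↔
      ∃ η, V.charRel θ η ∧ η.comp (QuotientGroup.mk' N) = φ := by
  have hN : (Nat.card N : ℂ) ≠ 0 := by exact_mod_cast Nat.card_pos.ne'
  constructor
  · intro h
    have hφ : φ.domRestrict N = 1 := by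
      by_contra hφ
      have h1 := (charRel_iff_of_star_of_ne_one hin hout hφ).1 (S.charRel.symm h)
      rw [MonoidHom.domRestrict_comp_mk] at h1
      exact hφ (U.eq_one_of_charRel_one (U.charRel.symm h1))
    obtain ⟨η, rfl⟩ := MonoidHom.exists_comp_mk_eq hφ
    refine ⟨η, ?_, rfl⟩
    rw [charRel_iff_classSum] at h ⊢
    intro q
    obtain ⟨g, rfl⟩ := QuotientGroup.mk_surjective q
    by_cases hg : g ∈ N
    -- The class of the identity of `G ⧸ N` is not seen outside `N`, but its class sums are all `1`.
    · rw [(QuotientGroup.eq_one_iff g).2 hg, classSum_one, classSum_one]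
    · have := h g
      rw [classSum_comp_mk_of_star hout _ hg, classSum_comp_mk_of_star hout _ hg] at this
      exact mul_left_cancel₀ hN this
  · rintro ⟨η, h, rfl⟩
    rw [charRel_iff_classSum] at h ⊢
    intro g
    by_cases hg : g ∈ N
    · rw [classSum_of_star_of_mem hin hout _ ⟨g, hg⟩, classSum_of_star_of_mem hin hout _ ⟨g, hg⟩,
        MonoidHom.domRestrict_comp_mk, MonoidHom.domRestrict_comp_mk]
    · rw [classSum_comp_mk_of_star hout _ hg, classSum_comp_mk_of_star hout _ hg, h]

theorem superchar_comp_mk_of_star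
    (hin : ∀ x y : N, S.classRel x y ↔ U.classRel x y)
    (hout : ∀ g h : G, g ∉ N → (S.classRel g h ↔ V.classRel (g : G ⧸ N) (h : G ⧸ N)))
    (θ : (G ⧸ N) →* ℂˣ) :
    S.superchar (θ.comp (QuotientGroup.mk' N)) = fun g : G => V.superchar θ (g : G ⧸ N) := by
  funext g
  have : {φ | S.charRel (θ.comp (QuotientGroup.mk' N)) φ} =
      (fun η : (G ⧸ N) →* ℂˣ => η.comp (QuotientGroup.mk' N)) '' {η | V.charRel θ η} := by
    ext φ
    exact charRel_comp_mk_iff_of_star hin hout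
  have hinj : Function.Injective (fun η : (G ⧸ N) →* ℂˣ => η.comp (QuotientGroup.mk' N)) :=
    fun _ _ h => (MonoidHom.cancel_right (QuotientGroup.mk'_surjective N)).1 h
  rw [superchar, this, finsum_mem_image hinj.injOn]
  rfl

open scoped Classical in
/-- Induction in an abelian group: conjugation is trivial, so the sum over `G` is a multiple. -/
theorem induced_apply (f : N → ℂ) (g : G) :
    induced N f g = if h : g ∈ N then (Nat.card (G ⧸ N) : ℂ) * f ⟨g, h⟩ else 0 := by
  have : Fintype G := Fintype.ofFinite _
  have hN : (Nat.card N : ℂ) ≠ 0 := by exact_mod_cast Nat.card_pos.ne'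
  have hc : (Nat.card G : ℂ) = Nat.card (G ⧸ N) * Nat.card N := by
    exact_mod_cast N.card_eq_card_quotient_mul_card_subgroup
  have hconj : ∀ x : G, x * g * x⁻¹ = g := fun x => by rw [mul_comm x, mul_inv_cancel_right]
  rw [induced]
  simp only [hconj]
  rw [finsum_eq_sum_of_fintype]
  by_cases h : g ∈ N
  · simp only [h, dite_true]
    rw [Finset.sum_congr rfl (g := fun _ => f ⟨g, h⟩) fun _ _ => rfl, Finset.sum_const,
      Finset.card_univ, ← Nat.card_eq_fintype_card, nsmul_eq_mul, hc]
    field_simp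
  · simp [h]

theorem superchar_of_star_of_ne_one
    (hin : ∀ x y : N, S.classRel x y ↔ U.classRel x y)
    (hout : ∀ g h : G, g ∉ N → (S.classRel g h ↔ V.classRel (g : G ⧸ N) (h : G ⧸ N)))
    {ψ : G →* ℂˣ} (hψ : ψ.domRestrict N ≠ 1) :
    S.superchar ψ = induced N (U.superchar (ψ.domRestrict N)) := by
  classical
  have : Fintype (G →* ℂˣ) := Fintype.ofFinite _
  have : Fintype (N →* ℂˣ) := Fintype.ofFinite _
  funext g
  rw [induced_apply, superchar_eq_sum]
  simp only [charRel_iff_of_star_of_ne_one hin hout hψ]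
  split_ifs with hg
  · rw [superchar_eq_sum, ← CommGroup.card_domRestrictHom_ker ℂ N,
      ← (MonoidHom.domRestrictHom N ℂˣ).sum_comp_of_surjective
        (MonoidHom.domRestrict_surjective ℂ N)]
    rfl
  · -- Multiplying by a character trivial on `N` but not at `g` permutes the part.
    obtain ⟨l, hl, hlg⟩ : ∃ l : G →* ℂˣ, (∀ y ∈ N, l y = 1) ∧ l g ≠ 1 := by
      by_contra! h
      exact hg ((CommGroup.forall_monoidHom_apply_eq_one_iff ℂ N g).1 h)
    set s := ∑ φ : G →* ℂˣ, if U.charRel (ψ.domRestrict N) (φ.domRestrict N) then (φ g : ℂ) else 0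
      with hs
    have h1 : s = (l g : ℂ) * s := by
      conv_lhs => rw [hs, ← Equiv.sum_comp (Equiv.mulLeft l)]
      rw [hs, Finset.mul_sum]
      refine Finset.sum_congr rfl fun φ _ => ?_
      have h2 : (l * φ).domRestrict N = φ.domRestrict N := by
        ext x
        simp [hl x x.2]
      simp [h2]
    have h3 : (l g : ℂ) ≠ 1 := fun e => hlg (Units.ext e)
    exact eq_zero_of_mul_eq_self_left h3 h1.symm

/-- The superclasses alone detect `∗`-products. -/
theorem isStarProduct_of_classRel
    (hin : ∀ x y : N, S.classRel x y ↔ U.classRel x y)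
    (hout : ∀ g h : G, g ∉ N → (S.classRel g h ↔ V.classRel (g : G ⧸ N) (h : G ⧸ N))) :
    S.IsStarProduct N U V := by
  refine ⟨classes_eq_of_star hin hout, ?_⟩
  simp only [supercharacters_eq_range]
  ext f
  constructor
  · rintro ⟨ψ, rfl⟩
    by_cases hψ : ψ.domRestrict N = 1
    · obtain ⟨θ, rfl⟩ := MonoidHom.exists_comp_mk_eq hψ
      exact Or.inl ⟨_, ⟨θ, rfl⟩, superchar_comp_mk_of_star hin hout θ⟩
    · exact Or.inr ⟨_, ⟨_, rfl⟩, fun e => hψ (U.superchar_eq_one_iff.1 e),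
        superchar_of_star_of_ne_one hin hout hψ⟩
  · rintro (⟨_, ⟨θ, rfl⟩, rfl⟩ | ⟨_, ⟨η, rfl⟩, h1, rfl⟩)
    · exact ⟨_, superchar_comp_mk_of_star hin hout θ⟩
    · obtain ⟨ψ, rfl⟩ := MonoidHom.domRestrict_surjective ℂ N η
      have hne : ψ.domRestrict N ≠ 1 := fun e => h1 (U.superchar_eq_one_iff.2 e)
      exact ⟨ψ, superchar_of_star_of_ne_one hin hout hne⟩

end Star

section Direct

variable {H : Subgroup G} {E : SupercharacterTheory H} {F : SupercharacterTheory N}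

/-- The hypothesis `hrel` here and below says that the superclasses of `S` are the products of
superclasses of `E` and of `F`. -/
theorem classSum_mul_of_direct (hc : Subgroup.IsComplement' H N)
    (hrel : ∀ (h h' : H) (k k' : N), S.classRel ((h : G) * k) ((h' : G) * k') ↔
      E.classRel h h' ∧ F.classRel k k') (ψ : G →* ℂˣ) (h : H) (k : N) :
    S.classSum ψ ((h : G) * k) =
      E.classSum (ψ.domRestrict H) h * F.classSum (ψ.domRestrict N) k := by
  classical
  have : Fintype G := Fintype.ofFinite _
  have : Fintype H := Fintype.ofFinite _
  have : Fintype N := Fintype.ofFinite _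
  rw [classSum_eq_sum, classSum_eq_sum, classSum_eq_sum, Finset.sum_mul_sum,
    ← Fintype.sum_prod_type', ← Equiv.sum_comp (Equiv.ofBijective _ hc)]
  refine Finset.sum_congr rfl fun x _ => ?_
  have e : Equiv.ofBijective _ hc x = (x.1 : G) * x.2 := rfl
  rw [e]
  have := hrel h x.1 k x.2
  simp only [this, map_mul, Units.val_mul, mul_inv, MonoidHom.domRestrict_apply]
  by_cases h1 : E.classRel h x.1 <;> by_cases h2 : F.classRel k x.2 <;> simp [h1, h2]

theorem charRel_iff_of_direct (hc : Subgroup.IsComplement' H N)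
    (hrel : ∀ (h h' : H) (k k' : N), S.classRel ((h : G) * k) ((h' : G) * k') ↔
      E.classRel h h' ∧ F.classRel k k') {ψ φ : G →* ℂˣ} :
    S.charRel ψ φ ↔ E.charRel (ψ.domRestrict H) (φ.domRestrict H) ∧
      F.charRel (ψ.domRestrict N) (φ.domRestrict N) := by
  simp only [charRel_iff_classSum]
  have key := classSum_mul_of_direct hc hrel
  constructor
  · intro h
    constructor
    · intro x
      have := h ((x : G) * (1 : N))
      rw [key, key] at this
      simpa [classSum_one] using this
    · intro x
      have := h (((1 : H) : G) * x)
      rw [key, key] at this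
      simpa [classSum_one] using this
  · rintro ⟨h1, h2⟩ g
    obtain ⟨⟨x, y⟩, rfl⟩ := hc.surjective g
    simp only [key, h1, h2]

/-- Restriction identifies the characters of an internal direct product with pairs of characters
of the factors. -/
theorem bijective_domRestrict_prod (hc : Subgroup.IsComplement' H N) :
    Function.Bijective
      (fun ψ : G →* ℂˣ => ((ψ.domRestrict H, ψ.domRestrict N) : (H →* ℂˣ) × (N →* ℂˣ))) := by
  refine (Nat.bijective_iff_injective_and_card _).2 ⟨fun ψ φ h => ?_, ?_⟩
  · ext g
    obtain ⟨⟨x, y⟩, rfl⟩ := hc.surjective g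
    have h1 := DFunLike.congr_fun (Prod.ext_iff.1 h).1 x
    have h2 := DFunLike.congr_fun (Prod.ext_iff.1 h).2 y
    simp only [MonoidHom.domRestrict_apply] at h1 h2
    simp only [map_mul, h1, h2]
  · rw [Nat.card_prod, CommGroup.card_monoidHom_of_hasEnoughRootsOfUnity,
      CommGroup.card_monoidHom_of_hasEnoughRootsOfUnity,
      CommGroup.card_monoidHom_of_hasEnoughRootsOfUnity, hc.card_mul_card]

theorem superchar_mul_of_direct (hc : Subgroup.IsComplement' H N)
    (hrel : ∀ (h h' : H) (k k' : N), S.classRel ((h : G) * k) ((h' : G) * k') ↔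
      E.classRel h h' ∧ F.classRel k k') (ψ : G →* ℂˣ) (h : H) (k : N) :
    S.superchar ψ ((h : G) * k) =
      E.superchar (ψ.domRestrict H) h * F.superchar (ψ.domRestrict N) k := by
  classical
  have : Fintype (G →* ℂˣ) := Fintype.ofFinite _
  have : Fintype (H →* ℂˣ) := Fintype.ofFinite _
  have : Fintype (N →* ℂˣ) := Fintype.ofFinite _
  rw [superchar_eq_sum, superchar_eq_sum, superchar_eq_sum, Finset.sum_mul_sum,
    ← Fintype.sum_prod_type',
    ← Equiv.sum_comp (Equiv.ofBijective _ (bijective_domRestrict_prod hc))]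
  refine Finset.sum_congr rfl fun φ _ => ?_
  simp only [Equiv.ofBijective_apply, charRel_iff_of_direct hc hrel, map_mul, Units.val_mul,
    MonoidHom.domRestrict_apply]
  by_cases h1 : E.charRel (ψ.domRestrict H) (φ.domRestrict H) <;>
    by_cases h2 : F.charRel (ψ.domRestrict N) (φ.domRestrict N) <;> simp [h1, h2]

/-- The superclasses alone detect direct products. -/
theorem isDirectProduct_of_classRel (hc : Subgroup.IsComplement' H N)
    (hrel : ∀ (h h' : H) (k k' : N), S.classRel ((h : G) * k) ((h' : G) * k') ↔
      E.classRel h h' ∧ F.classRel k k') : S.IsDirectProduct H N E F := by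
  refine ⟨hc, ?_, ?_⟩
  · have hset : ∀ (h : H) (k : N), {x | S.classRel x ((h : G) * k)} =
        {x | ∃ h' ∈ {y | E.classRel y h}, ∃ k' ∈ {y | F.classRel y k},
          x = (h' : G) * (k' : G)} := by
      intro h k
      ext x
      constructor
      · intro hx
        obtain ⟨⟨a, b⟩, rfl⟩ := hc.surjective x
        exact ⟨a, ((hrel _ _ _ _).1 hx).1, b, ((hrel _ _ _ _).1 hx).2, rfl⟩
      · rintro ⟨a, ha, b, hb, rfl⟩
        exact (hrel _ _ _ _).2 ⟨ha, hb⟩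
    ext M
    rw [mem_classes_iff]
    constructor
    · rintro ⟨g, rfl⟩
      obtain ⟨⟨a, b⟩, rfl⟩ := hc.surjective g
      exact ⟨_, E.mem_classes_iff.2 ⟨a, rfl⟩, _, F.mem_classes_iff.2 ⟨b, rfl⟩, hset a b⟩
    · rintro ⟨K, hK, L, hL, rfl⟩
      obtain ⟨a, rfl⟩ := E.mem_classes_iff.1 hK
      obtain ⟨b, rfl⟩ := F.mem_classes_iff.1 hL
      exact ⟨(a : G) * b, (hset a b).symm⟩
  · simp only [supercharacters_eq_range]
    ext f
    constructor
    · rintro ⟨ψ, rfl⟩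
      exact ⟨_, ⟨ψ.domRestrict H, rfl⟩, _, ⟨ψ.domRestrict N, rfl⟩,
        superchar_mul_of_direct hc hrel ψ⟩
    · rintro ⟨_, ⟨α, rfl⟩, _, ⟨β, rfl⟩, hf⟩
      obtain ⟨ψ, hψ⟩ := (bijective_domRestrict_prod hc).2 (α, β)
      obtain ⟨rfl, rfl⟩ := Prod.ext_iff.1 hψ
      refine ⟨ψ, ?_⟩
      funext g
      obtain ⟨⟨a, b⟩, rfl⟩ := hc.surjective g
      simp only
      rw [superchar_mul_of_direct hc hrel, hf]

theorem isRestriction_left_of_direct (hc : Subgroup.IsComplement' H N)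
    (hrel : ∀ (h h' : H) (k k' : N), S.classRel ((h : G) * k) ((h' : G) * k') ↔
      E.classRel h h' ∧ F.classRel k k') : S.IsRestriction H E := by
  have hmem : ∀ (h : H) x, S.classRel h x ↔ ∃ h' : H, x = h' ∧ E.classRel h h' := by
    intro h x
    constructor
    · intro hx
      obtain ⟨⟨a, b⟩, rfl⟩ := hc.surjective x
      have h1 : S.classRel ((h : G) * (1 : N)) ((a : G) * b) := by simpa using hx
      have h2 := (hrel _ _ _ _).1 h1
      refine ⟨a, ?_, h2.1⟩
      simp [F.eq_one_of_classRel_one h2.2]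
    · rintro ⟨a, rfl, ha⟩
      have := (hrel h a 1 1).2 ⟨ha, F.classRel.refl _⟩
      simpa using this
  have himage : ∀ h : H, {x | S.classRel x h} = (fun x : H => (x : G)) '' {x | E.classRel x h} := by
    intro h
    ext x
    refine (S.classRel.comm'.trans (hmem h x)).trans ?_
    constructor
    · rintro ⟨a, rfl, ha⟩
      exact ⟨a, E.classRel.symm ha, rfl⟩
    · rintro ⟨a, ha, rfl⟩
      exact ⟨a, rfl, E.classRel.symm ha⟩
  have hval : ∀ (ψ : G →* ℂˣ) (x : H), S.superchar ψ x =
      F.superchar (ψ.domRestrict N) 1 * E.superchar (ψ.domRestrict H) x := by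
    intro ψ x
    rw [mul_comm, ← superchar_mul_of_direct hc hrel ψ x 1, Subgroup.coe_one, mul_one]
  refine ⟨?_, ?_, ?_, ?_⟩
  · rintro K hK ⟨h, hhK, hhH⟩ x hx
    obtain ⟨a, rfl, -⟩ := (hmem ⟨h, hhH⟩ x).1 (S.classRel_iff.2 ⟨K, hK, hhK, hx⟩)
    exact a.2
  · ext L
    rw [mem_classes_iff]
    constructor
    · rintro ⟨h, rfl⟩
      exact S.mem_classes_iff.2 ⟨h, (himage h).symm⟩
    · intro hL
      obtain ⟨g, hg⟩ := S.mem_classes_iff.1 hL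
      obtain ⟨h, -, rfl⟩ : g ∈ (fun x : H => (x : G)) '' L := hg ▸ S.classRel.refl g
      rw [himage h] at hg
      exact ⟨h, Subtype.val_injective.image_injective hg⟩
  · simp only [supercharacters_eq_range]
    rintro _ ⟨ψ, rfl⟩
    exact ⟨_, ⟨ψ.domRestrict H, rfl⟩, _, F.superchar_apply_one_ne_zero _, hval ψ⟩
  · simp only [supercharacters_eq_range]
    rintro _ ⟨α, rfl⟩
    obtain ⟨ψ, rfl⟩ := MonoidHom.domRestrict_surjective ℂ H α
    exact ⟨_, ⟨ψ, rfl⟩, _, F.superchar_apply_one_ne_zero _, hval ψ⟩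

theorem isDirectProductOver_of_classRel (hc : Subgroup.IsComplement' H N)
    (hrel : ∀ (h h' : H) (k k' : N), S.classRel ((h : G) * k) ((h' : G) * k') ↔
      E.classRel h h' ∧ F.classRel k k') : S.IsDirectProductOver H N := by
  refine ⟨E, F, isRestriction_left_of_direct hc hrel,
    isRestriction_left_of_direct (F := E) hc.symm fun h h' k k' => ?_,
    isDirectProduct_of_classRel hc hrel⟩
  rw [mul_comm, mul_comm (h' : G), hrel, and_comm]

end Direct

end Products

end SupercharacterTheory

/-! ### Orbits of powers -/

section PowerOrbits

variable {P : Type*} [CommGroup P] {p : ℕ} [Fact p.Prime]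

theorem Subgroup.card_quotient_eq_of_card {N : Subgroup P} (hcard : Nat.card P = p ^ 2)
    (hN : Nat.card N = p) : Nat.card (P ⧸ N) = p := by
  have h := N.card_eq_card_quotient_mul_card_subgroup
  rw [hcard, hN, sq] at h
  exact (Nat.eq_of_mul_eq_mul_right (Fact.out : p.Prime).pos h).symm

theorem Subgroup.card_zpowers_eq_of_ne_one (hexp : ∀ x : P, x ^ p = 1) {h : P} (h1 : h ≠ 1) :
    Nat.card (Subgroup.zpowers h) = p := by
  rw [Nat.card_zpowers]
  exact orderOf_eq_prime (hexp h) h1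

theorem pow_val_mul (hexp : ∀ x : P, x ^ p = 1) (x : P) (a b : (ZMod p)ˣ) :
    x ^ (a * b : (ZMod p)ˣ).val.val = (x ^ a.val.val) ^ b.val.val := by
  rw [Units.val_mul, ZMod.val_mul, ← pow_eq_pow_mod _ (hexp x), pow_mul]

theorem pow_val_one (x : P) : x ^ (1 : (ZMod p)ˣ).val.val = x := by
  rw [Units.val_one, ZMod.val_one, pow_one]

theorem pow_val_inv (hexp : ∀ x : P, x ^ p = 1) (x : P) (a : (ZMod p)ˣ) :
    (x ^ a.val.val) ^ (a⁻¹).val.val = x := by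
  rw [← pow_val_mul hexp, mul_inv_cancel, pow_val_one]

theorem exists_unit_pow_eq (hexp : ∀ x : P, x ^ p = 1) {m : ℕ} (hm : m.Coprime p) :
    ∃ a : (ZMod p)ˣ, ∀ x : P, x ^ m = x ^ a.val.val :=
  ⟨ZMod.unitOfCoprime m hm, fun x => by
    rw [ZMod.coe_unitOfCoprime, ZMod.val_natCast, ← pow_eq_pow_mod _ (hexp x)]⟩

theorem coprime_of_pow_ne_one (hexp : ∀ x : P, x ^ p = 1) {x : P} {m : ℕ} (h : x ^ m ≠ 1) :
    m.Coprime p := by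
  rw [Nat.coprime_comm, (Fact.out : p.Prime).coprime_iff_not_dvd]
  rintro ⟨k, rfl⟩
  exact h (by rw [pow_mul, hexp, one_pow])

/-- The equivalence relation on a group of exponent `p` whose classes are the orbits of the group
`A` of units modulo `p`, acting by powers. -/
def powSetoid (hexp : ∀ x : P, x ^ p = 1) (A : Subgroup (ZMod p)ˣ) : Setoid P where
  r x y := ∃ a ∈ A, y = x ^ a.val.val
  iseqv :=
    { refl := fun x => ⟨1, A.one_mem, (pow_val_one x).symm⟩
      symm := by
        rintro x _ ⟨a, ha, rfl⟩
        exact ⟨a⁻¹, A.inv_mem ha, (pow_val_inv hexp x a).symm⟩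
      trans := by
        rintro x _ _ ⟨a, ha, rfl⟩ ⟨b, hb, rfl⟩
        exact ⟨a * b, A.mul_mem ha hb, (pow_val_mul hexp x a b).symm⟩ }

/-- The units `a` modulo `p` such that `g ^ a` is related to `g`. -/
def powStabilizer (hexp : ∀ x : P, x ^ p = 1) (r : Setoid P)
    (hpow : ∀ m : ℕ, ∀ x y, r x y → r (x ^ m) (y ^ m)) (g : P) : Subgroup (ZMod p)ˣ where
  carrier := {a | r g (g ^ a.val.val)}
  one_mem' := by
    change r g _
    rw [pow_val_one]
  mul_mem' := by
    intro a b ha hb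
    change r g _
    rw [pow_val_mul hexp]
    exact r.trans hb (hpow _ _ _ ha)
  inv_mem' := by
    intro a ha
    change r g _
    have h := hpow (a⁻¹ : (ZMod p)ˣ).val.val _ _ ha
    rw [pow_val_inv hexp] at h
    exact r.symm h

/-- On the powers of one element `g`, a relation stable under powers is given by orbits of powers:
this is the description of the supercharacter theories of groups of prime order. -/
theorem rel_pow_iff_exists_powStabilizer (hexp : ∀ x : P, x ^ p = 1) (r : Setoid P)
    (hpow : ∀ m : ℕ, ∀ x y, r x y → r (x ^ m) (y ^ m)) (hone : ∀ x, r 1 x → x = 1) {g x y : P}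
    {i j : ℕ} (hx : x = g ^ i) (hy : y = g ^ j) :
    r x y ↔ ∃ a ∈ powStabilizer hexp r hpow g, y = x ^ a.val.val := by
  by_cases h1 : x = 1
  · rw [h1]
    simp only [one_pow]
    exact ⟨fun h => ⟨1, Subgroup.one_mem _, hone y h⟩, fun ⟨_, _, h⟩ => h ▸ r.refl _⟩
  · subst hx hy
    obtain ⟨u, hu⟩ := exists_unit_pow_eq hexp (coprime_of_pow_ne_one hexp h1)
    constructor
    · intro h
      have h2 : g ^ j ≠ 1 := fun e => h1 (hone _ (r.symm (e ▸ h)))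
      obtain ⟨v, hv⟩ := exists_unit_pow_eq hexp (coprime_of_pow_ne_one hexp h2)
      refine ⟨u⁻¹ * v, ?_, ?_⟩
      · have h3 := hpow (u⁻¹ : (ZMod p)ˣ).val.val _ _ h
        rw [hu, pow_val_inv hexp, hv, ← pow_val_mul hexp, mul_comm] at h3
        exact h3
      · rw [hu, hv, ← pow_val_mul hexp, mul_inv_cancel_left]
    · rintro ⟨a, ha, h⟩
      rw [h, ← pow_mul, mul_comm, pow_mul]
      have := hpow i _ _ ha
      rwa [← pow_mul, mul_comm, pow_mul] at this ⊢

end PowerOrbits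

namespace SupercharacterTheory

section PowerTheory

variable {H : Type*} [CommGroup H] [Finite H] {p : ℕ} [Fact p.Prime]

/-- The supercharacter theory of a group of exponent dividing `p` whose superclasses and parts of
the set of characters are the orbits of the group `A` of units modulo `p`, acting by powers. -/
noncomputable def powTheory (hexp : ∀ x : H, x ^ p = 1) (A : Subgroup (ZMod p)ˣ) :
    SupercharacterTheory H where
  charParts := (powSetoid (P := H →* ℂˣ)
    (fun ψ => MonoidHom.ext fun x => by rw [MonoidHom.pow_apply, ← map_pow, hexp, map_one]; rfl)
    A).classes
  classes := (powSetoid hexp A).classes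
  isPartition_charParts := Setoid.isPartition_classes _
  isPartition_classes := Setoid.isPartition_classes _
  ncard_eq := by
    -- A group isomorphic to its group of characters has as many orbits of powers.
    obtain ⟨e⟩ := CommGroup.monoidHom_mulEquiv_of_hasEnoughRootsOfUnity H ℂ
    rw [← Set.ncard_image_of_injective _ e.injective.image_injective]
    have himage : ∀ ψ : H →* ℂˣ, e '' {φ | ∃ a ∈ A, ψ = φ ^ a.val.val} =
        {x | ∃ a ∈ A, e ψ = x ^ a.val.val} := by
      intro ψ
      ext x
      constructor
      · rintro ⟨φ, ⟨a, ha, rfl⟩, rfl⟩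
        exact ⟨a, ha, map_pow e _ _⟩
      · rintro ⟨a, ha, h⟩
        exact ⟨e.symm x, ⟨a, ha, by rw [← map_pow, ← h, e.symm_apply_apply]⟩,
          e.apply_symm_apply x⟩
    congr 1
    ext K
    constructor
    · rintro ⟨_, ⟨ψ, rfl⟩, rfl⟩
      exact ⟨e ψ, himage ψ⟩
    · rintro ⟨x, rfl⟩
      refine ⟨_, ⟨e.symm x, rfl⟩, (himage _).trans ?_⟩
      rw [e.apply_symm_apply]
      rfl
  singleton_one_mem := by
    refine ⟨1, ?_⟩
    ext x
    constructor
    · rintro rfl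
      exact (powSetoid hexp A).refl _
    · intro h
      obtain ⟨a, -, rfl⟩ := (powSetoid hexp A).symm h
      exact one_pow _
  exists_character := by
    classical
    have : Fintype (H →* ℂˣ) := Fintype.ofFinite _
    have hexp' : ∀ ψ : H →* ℂˣ, ψ ^ p = 1 :=
      fun ψ => MonoidHom.ext fun x => by rw [MonoidHom.pow_apply, ← map_pow, hexp, map_one]; rfl
    rintro _ ⟨χ, rfl⟩
    let n : (H →* ℂˣ) →₀ ℕ :=
      Finsupp.equivFunOnFinite.symm fun ψ => if powSetoid hexp' A ψ χ then 1 else 0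
    have hn : ∀ ψ, n ψ = if powSetoid hexp' A ψ χ then 1 else 0 := fun ψ => rfl
    refine ⟨n, fun h => ?_, fun ψ hψ => ?_, ?_⟩
    · have := DFunLike.congr_fun h χ
      rw [hn, if_pos ((powSetoid hexp' A).refl _)] at this
      exact one_ne_zero this
    · by_contra h
      have h' : ¬ powSetoid hexp' A ψ χ := h
      rw [Finsupp.mem_support_iff, hn, if_neg h'] at hψ
      exact hψ rfl
    · rintro _ ⟨k, rfl⟩ g hg h hh
      obtain ⟨a, ha, rfl⟩ := (powSetoid hexp A).trans hg ((powSetoid hexp A).symm hh)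
      rw [Finsupp.sum_fintype _ _ (by simp), Finsupp.sum_fintype _ _ (by simp)]
      let e : (H →* ℂˣ) ≃ (H →* ℂˣ) :=
        { toFun := fun ψ => ψ ^ a.val.val
          invFun := fun ψ => ψ ^ (a⁻¹).val.val
          left_inv := fun ψ => pow_val_inv hexp' ψ a
          right_inv := fun ψ => by
            have := pow_val_inv hexp' ψ a⁻¹
            rwa [inv_inv] at this }
      rw [← Equiv.sum_comp e]
      refine Finset.sum_congr rfl fun ψ _ => ?_
      have h1 : powSetoid hexp' A ψ (e ψ) := ⟨a, ha, rfl⟩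
      have h2 : powSetoid hexp' A (e ψ) χ ↔ powSetoid hexp' A ψ χ :=
        ⟨(powSetoid hexp' A).trans h1, (powSetoid hexp' A).trans ((powSetoid hexp' A).symm h1)⟩
      rw [hn, hn]
      simp only [h2]
      congr 1
      change ((ψ ^ a.val.val) g : ℂ) = _
      rw [MonoidHom.pow_apply, map_pow]

theorem classRel_powTheory (hexp : ∀ x : H, x ^ p = 1) (A : Subgroup (ZMod p)ˣ) {x y : H} :
    (powTheory hexp A).classRel x y ↔ ∃ a ∈ A, y = x ^ a.val.val := by
  have : (powTheory hexp A).classRel = powSetoid hexp A := Setoid.mkClasses_classes _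
  rw [this]
  rfl

theorem classRel_powTheory_bot (hexp : ∀ x : H, x ^ p = 1) {x y : H} :
    (powTheory hexp ⊥).classRel x y ↔ x = y := by
  rw [classRel_powTheory]
  simp only [Subgroup.mem_bot, exists_eq_left, pow_val_one, eq_comm]

end PowerTheory

/-! ### Groups of order `p ^ 2` and exponent `p` -/

section ElementaryAbelian

variable {G : Type*} [CommGroup G] [Finite G] {p : ℕ} [Fact p.Prime]

theorem classRel_pow_of_card (S : SupercharacterTheory G) (hcard : Nat.card G = p ^ 2)
    (hexp : ∀ x : G, x ^ p = 1) (m : ℕ) (x y : G) (h : S.classRel x y) :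
    S.classRel (x ^ m) (y ^ m) := by
  by_cases hm : m.Coprime p
  · exact S.classRel_pow (by rw [hcard]; exact hm.pow_right 2) h
  · rw [Nat.coprime_comm, (Fact.out : p.Prime).coprime_iff_not_dvd, not_not] at hm
    obtain ⟨k, rfl⟩ := hm
    simp only [pow_mul, hexp, one_pow]
    exact S.classRel.refl _

theorem _root_.Subgroup.card_eq_of_ne_bot_of_ne_top {N : Subgroup G}
    (hcard : Nat.card G = p ^ 2) (h1 : N ≠ ⊥) (h2 : N ≠ ⊤) : Nat.card N = p := by
  have hd := N.card_subgroup_dvd_card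
  rw [hcard, Nat.dvd_prime_pow Fact.out] at hd
  obtain ⟨k, hk, e⟩ := hd
  interval_cases k
  · exact absurd (Subgroup.card_eq_one.1 (by simpa using e)) h1
  · simpa using e
  · exact absurd (Subgroup.eq_top_of_card_eq N (e.trans hcard.symm)) h2

theorem notMem_center_of_classRel (S : SupercharacterTheory G) {g h : G}
    (hgh : S.classRel g h) (hg : g ∉ S.center) : h ∉ S.center := fun hh =>
  hg (S.mem_center_iff.1 hh g (S.classRel.symm hgh) ▸ hh)

/-- The powers `g₀ ^ m` of one element `g₀` outside `Z(S)` meet every superclass outside `Z(S)`, so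
the theory of the quotient is given by the units `a` with `g₀ ^ a` in the superclass of `g₀`. -/
theorem isStarProductOver_center_of_stable (S : SupercharacterTheory G)
    (hcard : Nat.card G = p ^ 2) (hexp : ∀ x : G, x ^ p = 1) (hZ : Nat.card S.center = p)
    (hst : ∀ g, g ∉ S.center → ∀ z ∈ S.center, S.classRel g (g * z)) :
    S.IsStarProductOver S.center := by
  have hI := Subgroup.card_quotient_eq_of_card hcard hZ
  have hpow := S.classRel_pow_of_card hcard hexp
  obtain ⟨g₀, hg₀⟩ := Subgroup.exists_notMem_of_card_quotient hI
  have hexpQ : ∀ x : G ⧸ S.center, x ^ p = 1 := fun x => by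
    obtain ⟨g, rfl⟩ := QuotientGroup.mk_surjective x
    rw [← QuotientGroup.mk_pow, hexp, QuotientGroup.mk_one]
  have hexpZ : ∀ x : S.center, x ^ p = 1 := fun x => Subtype.ext (hexp x)
  -- Every element outside the centre is related to a power of `g₀`.
  have hrep : ∀ g, g ∉ S.center → ∃ m : ℕ, ∃ z ∈ S.center, g = g₀ ^ m * z ∧
      S.classRel (g₀ ^ m) g := by
    intro g hg
    obtain ⟨m, z, hz, rfl⟩ := Subgroup.exists_eq_pow_mul hI hg₀ g
    exact ⟨m, z, hz, rfl, hst _ (fun h => hg (S.center.mul_mem h hz)) z hz⟩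
  refine ⟨powTheory hexpZ ⊥, powTheory hexpQ (powStabilizer hexp S.classRel hpow g₀),
    isStarProduct_of_classRel (fun x y => ?_) fun g h hg => ?_⟩
  · rw [classRel_powTheory_bot]
    refine ⟨fun hxy => Subtype.ext (S.mem_center_iff.1 x.2 y hxy).symm, ?_⟩
    rintro rfl
    exact S.classRel.refl _
  · rw [classRel_powTheory]
    obtain ⟨m, z, hz, hgz, hgm⟩ := hrep g hg
    constructor
    · intro hgh
      obtain ⟨n, w, hw, hhw, hhn⟩ := hrep h (S.notMem_center_of_classRel hgh hg)
      obtain ⟨a, ha, e⟩ := (rel_pow_iff_exists_powStabilizer hexp S.classRel hpow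
        (fun _ => S.eq_one_of_classRel_one) rfl rfl).1
        (S.classRel.trans hgm (S.classRel.trans hgh (S.classRel.symm hhn)))
      refine ⟨a, ha, ?_⟩
      rw [hhw, hgz, QuotientGroup.mk_mul_of_mem _ hw, QuotientGroup.mk_mul_of_mem _ hz, e,
        QuotientGroup.mk_pow]
    · rintro ⟨a, ha, e⟩
      have h1 : S.classRel (g ^ a.val.val) h := by
        rw [← QuotientGroup.mk_pow] at e
        have := hst _ (pow_notMem_of_coprime hexp (ZMod.val_coe_unit_coprime a) hg) _
          (QuotientGroup.eq.1 e.symm)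
        rwa [mul_inv_cancel_left] at this
      refine S.classRel.trans (S.classRel.symm hgm) (S.classRel.trans ?_
        (S.classRel.trans (hpow a.val.val _ _ hgm) h1))
      exact (rel_pow_iff_exists_powStabilizer hexp S.classRel hpow
        (fun _ => S.eq_one_of_classRel_one) (i := m) (j := m * a.val.val) rfl
        (by rw [pow_mul])).2 ⟨a, ha, rfl⟩

theorem isStarProductOver_commutator_of_stable (S : SupercharacterTheory G)
    (hcard : Nat.card G = p ^ 2) (hexp : ∀ x : G, x ^ p = 1) (hN : Nat.card S.commutator = p)
    (hst : ∀ g, g ∉ S.commutator → ∀ n ∈ S.commutator, S.classRel g (g * n)) :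
    S.IsStarProductOver S.commutator := by
  have hpow := S.classRel_pow_of_card hcard hexp
  obtain ⟨n₀, hn₀, hne⟩ : ∃ n ∈ S.commutator, n ≠ 1 := by
    refine S.commutator.bot_or_exists_ne_one.resolve_left fun h => ?_
    rw [h, Subgroup.card_bot] at hN
    exact (Fact.out : p.Prime).one_lt.ne hN
  have hexpQ : ∀ x : G ⧸ S.commutator, x ^ p = 1 := fun x => by
    obtain ⟨g, rfl⟩ := QuotientGroup.mk_surjective x
    rw [← QuotientGroup.mk_pow, hexp, QuotientGroup.mk_one]
  have hexpN : ∀ x : S.commutator, x ^ p = 1 := fun x => Subtype.ext (hexp x)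
  refine ⟨powTheory hexpN (powStabilizer hexp S.classRel hpow n₀), powTheory hexpQ ⊥,
    isStarProduct_of_classRel (fun x y => ?_) fun g h hg => ?_⟩
  · obtain ⟨i, hi⟩ := Subgroup.exists_eq_pow_of_card hN hn₀ x.2 hne
    obtain ⟨j, hj⟩ := Subgroup.exists_eq_pow_of_card hN hn₀ y.2 hne
    rw [classRel_powTheory, rel_pow_iff_exists_powStabilizer hexp S.classRel hpow
      (fun _ => S.eq_one_of_classRel_one) hi hj]
    simp only [Subtype.ext_iff, Subgroup.coe_pow]
  · rw [classRel_powTheory_bot, QuotientGroup.eq]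
    refine ⟨S.inv_mul_mem_commutator, fun h1 => ?_⟩
    have := hst g hg _ h1
    rwa [mul_inv_cancel_left] at this

theorem eq_one_of_mem_zpowers_of_mem (hexp : ∀ x : G, x ^ p = 1) {N : Subgroup G} {h x : G}
    (hh : h ∉ N) (hx : x ∈ Subgroup.zpowers h) (hxN : x ∈ N) : x = 1 := by
  obtain ⟨m, rfl⟩ := mem_powers_iff_mem_zpowers.2 hx
  by_contra h1
  exact pow_notMem_of_coprime hexp (coprime_of_pow_ne_one hexp h1) hh hxN

theorem commutator_eq_bot_iff (S : SupercharacterTheory G) : S.commutator = ⊥ ↔ S.center = ⊤ := by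
  rw [← le_bot_iff, commutator_le_iff, Subgroup.eq_top_iff']
  simp only [mem_center_iff, Subgroup.mem_bot, inv_mul_eq_one, eq_comm]

/-- If the superclass of `h` lies in `⟨h⟩`, then so does that of every power of `h`; the
superclasses of `S` are the translates of these by `Z(S)`, and `[G, S] = ⟨h⟩`. -/
theorem isDirectProductOver_of_powers (S : SupercharacterTheory G)
    (hcard : Nat.card G = p ^ 2) (hexp : ∀ x : G, x ^ p = 1) (hZ : Nat.card S.center = p) {h : G}
    (hh : h ∉ S.center) (hpw : ∀ x, S.classRel h x → ∃ m : ℕ, x = h ^ m) :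
    S.IsDirectProductOver S.center S.commutator := by
  have hpow := S.classRel_pow_of_card hcard hexp
  have h1 : h ≠ 1 := fun e => hh (e ▸ S.center.one_mem)
  set H := Subgroup.zpowers h with hH
  have hHc : Nat.card H = p := Subgroup.card_zpowers_eq_of_ne_one hexp h1
  have hexpH : ∀ x : H, x ^ p = 1 := fun x => Subtype.ext (hexp x)
  have hexpZ : ∀ x : S.center, x ^ p = 1 := fun x => Subtype.ext (hexp x)
  have hc : Subgroup.IsComplement' S.center H := by
    refine Subgroup.isComplement'_of_card_mul_and_disjoint (by rw [hZ, hHc, hcard, sq]) ?_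
    rw [Subgroup.disjoint_def]
    exact fun hx hxH => eq_one_of_mem_zpowers_of_mem hexp hh hxH hx
  have hpowH : ∀ k : H, ∃ i : ℕ, (k : G) = h ^ i := fun k => by
    obtain ⟨i, hi⟩ := mem_powers_iff_mem_zpowers.2 k.2
    exact ⟨i, hi.symm⟩
  -- Powers of `h` are related to powers of `h` only.
  have hclass : ∀ k ∈ H, ∀ x, S.classRel k x → x ∈ H := by
    intro k hk x hkx
    by_cases hk1 : k = 1
    · rw [hk1] at hkx
      rw [S.eq_one_of_classRel_one hkx]
      exact H.one_mem
    · obtain ⟨i, hi⟩ := hpowH ⟨k, hk⟩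
      change k = h ^ i at hi
      rw [hi] at hk1
      obtain ⟨u, hu⟩ := exists_unit_pow_eq hexp (coprime_of_pow_ne_one hexp hk1)
      have h2 := hpow (u⁻¹ : (ZMod p)ˣ).val.val _ _ hkx
      rw [hi, hu, pow_val_inv hexp] at h2
      obtain ⟨m, hm⟩ := hpw _ h2
      have h3 := pow_val_inv hexp x u⁻¹
      rw [hm, ← pow_mul] at h3
      rw [← h3]
      exact H.pow_mem (Subgroup.mem_zpowers h) _
  have hrel : ∀ (z z' : S.center) (k k' : H), S.classRel ((z : G) * k) ((z' : G) * k') ↔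
      (powTheory hexpZ ⊥).classRel z z' ∧
        (powTheory hexpH (powStabilizer hexp S.classRel hpow h)).classRel k k' := by
    intro z z' k k'
    obtain ⟨i, hi⟩ := hpowH k
    obtain ⟨j, hj⟩ := hpowH k'
    have hF : (powTheory hexpH (powStabilizer hexp S.classRel hpow h)).classRel k k' ↔
        S.classRel k k' := by
      rw [classRel_powTheory, rel_pow_iff_exists_powStabilizer hexp S.classRel hpow
        (fun _ => S.eq_one_of_classRel_one) hi hj]
      simp only [Subtype.ext_iff, Subgroup.coe_pow]
    rw [hF, classRel_powTheory_bot]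
    constructor
    · intro hr
      have h2 := S.classRel_mul_left (S.center.inv_mem z.2) hr
      rw [inv_mul_cancel_left, ← mul_assoc] at h2
      have h3 := (H.mul_mem_cancel_right k'.2).1 (hclass k k.2 _ h2)
      have h4 := eq_one_of_mem_zpowers_of_mem hexp hh h3
        (S.center.mul_mem (S.center.inv_mem z.2) z'.2)
      rw [h4, one_mul] at h2
      exact ⟨Subtype.ext (inv_mul_eq_one.1 h4), h2⟩
    · rintro ⟨rfl, hr⟩
      exact S.classRel_mul_left z.2 hr
  have hle : S.commutator ≤ H := by
    rw [commutator_le_iff]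
    intro x y hxy
    obtain ⟨⟨z, k⟩, rfl⟩ := hc.surjective x
    obtain ⟨⟨z', k'⟩, rfl⟩ := hc.surjective y
    have h2 := ((hrel z z' k k').1 hxy).1
    rw [classRel_powTheory_bot] at h2
    subst h2
    have : ((z : G) * k)⁻¹ * ((z : G) * k') = (k : G)⁻¹ * k' := by group
    change ((z : G) * k)⁻¹ * ((z : G) * k') ∈ H
    rw [this]
    exact H.mul_mem (H.inv_mem k.2) k'.2
  have heq : S.commutator = H := by
    refine Subgroup.eq_of_le_of_card_ge hle ?_
    have hne : S.commutator ≠ ⊥ := fun e =>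
      hh (S.commutator_eq_bot_iff.1 e ▸ Subgroup.mem_top h)
    have htop : S.commutator ≠ ⊤ := fun e => by
      have : Nat.card H = Nat.card G := by
        rw [top_le_iff.1 (by rw [← e]; exact hle : ⊤ ≤ H), Subgroup.card_top]
      rw [hHc, hcard] at this
      have hp : p.Prime := Fact.out
      nlinarith [hp.two_le]
    rw [Subgroup.card_eq_of_ne_bot_of_ne_top hcard hne htop, hHc]
  rw [heq]
  exact isDirectProductOver_of_classRel hc hrel

/-- An automorphism fixing `Z(S)` pointwise and moving `g` to a related element `k` preserves every
superclass, because `z * g ^ m` and `z * k ^ m` are related for all `z` in `Z(S)` and all `m`. -/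
theorem comesFromAutomorphisms_of_card_center (S : SupercharacterTheory G)
    (hcard : Nat.card G = p ^ 2) (hexp : ∀ x : G, x ^ p = 1) (hZ : Nat.card S.center = p) :
    S.ComesFromAutomorphisms := by
  have hI := Subgroup.card_quotient_eq_of_card hcard hZ
  refine S.comesFromAutomorphisms_of_exists fun g k hgk => ?_
  by_cases hg : g ∈ S.center
  · exact ⟨1, fun x => S.classRel.refl x, (S.mem_center_iff.1 hg k hgk).symm⟩
  · obtain ⟨f, hf, hfg⟩ := exists_mulAut_apply_eq hexp hI hg (S.notMem_center_of_classRel hgk hg)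
    refine ⟨f, fun x => ?_, hfg⟩
    obtain ⟨m, z, hz, rfl⟩ := Subgroup.exists_eq_pow_mul hI hg x
    rw [map_mul, map_pow, hfg, hf z hz, mul_comm, mul_comm _ z]
    exact S.classRel_mul_left hz (S.classRel_pow_of_card hcard hexp m _ _ hgk)

/-- When the superclasses outside `[G, S]` are its cosets, it suffices to look at automorphisms that
are trivial on `G ⧸ [G, S]` and act on `[G, S]` by a power preserving its superclasses. -/
theorem comesFromAutomorphisms_of_stable (S : SupercharacterTheory G)
    (hcard : Nat.card G = p ^ 2) (hexp : ∀ x : G, x ^ p = 1) (hN : Nat.card S.commutator = p)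
    (hst : ∀ g, g ∉ S.commutator → ∀ n ∈ S.commutator, S.classRel g (g * n)) :
    S.ComesFromAutomorphisms := by
  have hI := Subgroup.card_quotient_eq_of_card hcard hN
  have hst' : ∀ x y, x ∉ S.commutator → x⁻¹ * y ∈ S.commutator → S.classRel x y := by
    intro x y hx hxy
    have := hst x hx _ hxy
    rwa [mul_inv_cancel_left] at this
  have hmove : ∀ (g k c : G) (m : ℕ), S.classRel g k →
      (g ^ m * c)⁻¹ * (k ^ m * c) ∈ S.commutator := by
    intro g k c m hgk
    have : (g ^ m * c)⁻¹ * (k ^ m * c) = (g⁻¹ * k) ^ m := by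
      rw [mul_inv, mul_mul_mul_comm, inv_mul_cancel, mul_one, mul_pow, inv_pow]
    rw [this]
    exact S.commutator.pow_mem (S.inv_mul_mem_commutator hgk) m
  refine S.comesFromAutomorphisms_of_exists fun g k hgk => ?_
  have hk : g ∈ S.commutator ↔ k ∈ S.commutator := by
    have h1 := S.inv_mul_mem_commutator hgk
    refine ⟨fun hg => ?_, fun hk => ?_⟩
    · simpa using S.commutator.mul_mem hg h1
    · simpa using S.commutator.mul_mem hk (S.commutator.inv_mem h1)
  by_cases hg : g ∈ S.commutator
  · by_cases hg1 : g = 1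
    · rw [hg1] at hgk ⊢
      exact ⟨1, fun x => S.classRel.refl x, (S.eq_one_of_classRel_one hgk).symm⟩
    -- The automorphism acts on `[G, S]` and fixes a complement pointwise.
    obtain ⟨c, hc⟩ := Subgroup.exists_notMem_of_card_quotient hI
    have hc1 : c ≠ 1 := fun e => hc (e ▸ S.commutator.one_mem)
    have hk1 : k ≠ 1 := fun e => hg1 (S.eq_one_of_classRel_one (S.classRel.symm (e ▸ hgk)))
    have hCI := Subgroup.card_quotient_eq_of_card hcard
      (Subgroup.card_zpowers_eq_of_ne_one hexp hc1)
    have hgC : g ∉ Subgroup.zpowers c := fun h => hg1 (eq_one_of_mem_zpowers_of_mem hexp hc h hg)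
    have hkC : k ∉ Subgroup.zpowers c :=
      fun h => hk1 (eq_one_of_mem_zpowers_of_mem hexp hc h (hk.1 hg))
    obtain ⟨f, hf, hfg⟩ := exists_mulAut_apply_eq hexp hCI hgC hkC
    refine ⟨f, fun x => ?_, hfg⟩
    obtain ⟨m, d, hd, rfl⟩ := Subgroup.exists_eq_pow_mul hCI hgC x
    rw [map_mul, map_pow, hfg, hf d hd]
    by_cases hx : g ^ m * d ∈ S.commutator
    · have hd1 : d = 1 := eq_one_of_mem_zpowers_of_mem hexp hc hd
        ((S.commutator.mul_mem_cancel_left (S.commutator.pow_mem hg m)).1 hx)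
      rw [hd1, mul_one, mul_one]
      exact S.classRel_pow_of_card hcard hexp m _ _ hgk
    · exact hst' _ _ hx (hmove g k d m hgk)
  · obtain ⟨f, hf, hfg⟩ := exists_mulAut_apply_eq hexp hI hg (fun h => hg (hk.2 h))
    refine ⟨f, fun x => ?_, hfg⟩
    by_cases hx : x ∈ S.commutator
    · rw [hf x hx]
    · obtain ⟨m, n, hn, rfl⟩ := Subgroup.exists_eq_pow_mul hI hg x
      rw [map_mul, map_pow, hfg, hf n hn]
      exact hst' _ _ hx (hmove g k n m hgk)

/-- If `Z(S)` is trivial and `[G, S]` is a proper nontrivial subgroup, the superclasses outside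
`[G, S]` are cosets of it. The dichotomy is applied to the characters: its second alternative
would put the kernel of a character into `Z(S)`, and in the first all supercharacters nontrivial
on `[G, S]` vanish outside it. -/
theorem classRel_mul_of_center_eq_bot (S : SupercharacterTheory G)
    (hcard : Nat.card G = p ^ 2) (hexp : ∀ x : G, x ^ p = 1) (hN : Nat.card S.commutator = p)
    (hZ : S.center = ⊥) (g : G) (hg : g ∉ S.commutator) (n : G) (hn : n ∈ S.commutator) :
    S.classRel g (g * n) := by
  classical
  have hp : p.Prime := Fact.out
  have : Fintype (G →* ℂˣ) := Fintype.ofFinite _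
  have hI := Subgroup.card_quotient_eq_of_card hcard hN
  have hexp' : ∀ ψ : G →* ℂˣ, ψ ^ p = 1 :=
    fun ψ => MonoidHom.ext fun x => by rw [MonoidHom.pow_apply, ← map_pow, hexp, map_one]; rfl
  have hcard' : Nat.card (G →* ℂˣ) = p ^ 2 := by
    rw [CommGroup.card_monoidHom_of_hasEnoughRootsOfUnity, hcard]
  let D : Subgroup (G →* ℂˣ) := (MonoidHom.domRestrictHom S.commutator ℂˣ).ker
  have hD : ∀ l, l ∈ D ↔ {l} ∈ S.charParts := fun l => by
    rw [singleton_mem_charParts_iff_commutator]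
    refine ⟨fun h x hx => DFunLike.congr_fun (MonoidHom.mem_ker.1 h) ⟨x, hx⟩, fun h => ?_⟩
    exact MonoidHom.mem_ker.2 (MonoidHom.ext fun x => h x x.2)
  have hDc : Nat.card D = p := (CommGroup.card_domRestrictHom_ker ℂ S.commutator).trans hI
  have hDI := Subgroup.card_quotient_eq_of_card hcard' hDc
  have hpow : ∀ m : ℕ, m.Coprime p → ∀ ψ φ, S.charRel ψ φ → S.charRel (ψ ^ m) (φ ^ m) :=
    fun m hm ψ φ h => S.charRel_pow (by rw [hcard]; exact hm.pow_right 2) h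
  rcases S.charRel.stable_or_exists_powers hexp' hDc hDI
    (fun l hl ψ h => S.singleton_mem_charParts_iff.1 ((hD l).1 hl) ψ h)
    (fun l hl ψ φ h => S.charRel_mul_left ((hD l).1 hl) h) hpow with hst | ⟨μ, hμ, hpw⟩
  · -- It suffices to compare the supercharacters at `g` and `g * n`.
    have hvan : ∀ a : (G →* ℂˣ) → ℂ, (∀ ψ φ, S.charRel ψ φ → a ψ = a φ) → ∀ x, x ∉ S.commutator →
        ∑ ψ, (if ψ ∈ D then 0 else a ψ) * (ψ x : ℂ) = 0 := by
      intro a ha x hx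
      obtain ⟨l, hl, hlx⟩ : ∃ l : G →* ℂˣ, (∀ y ∈ S.commutator, l y = 1) ∧ l x ≠ 1 := by
        by_contra! h
        exact hx ((CommGroup.forall_monoidHom_apply_eq_one_iff ℂ S.commutator x).1 h)
      have hlD : l ∈ D := (hD l).2 ((S.singleton_mem_charParts_iff_commutator l).2 hl)
      set s := ∑ ψ, (if ψ ∈ D then 0 else a ψ) * (ψ x : ℂ) with hs
      have h1 : s = (l x : ℂ) * s := by
        conv_lhs => rw [hs, ← Equiv.sum_comp (Equiv.mulRight l)]
        rw [hs, Finset.mul_sum]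
        refine Finset.sum_congr rfl fun ψ _ => ?_
        simp only [Equiv.coe_mulRight, D.mul_mem_cancel_right hlD, MonoidHom.mul_apply,
          Units.val_mul]
        split_ifs with hψ
        · simp
        · rw [← ha _ _ (hst ψ hψ l hlD)]
          ring
      have h3 : (l x : ℂ) ≠ 1 := fun e => hlx (Units.ext e)
      exact eq_zero_of_mul_eq_self_left h3 h1.symm
    refine S.classRel_of_forall fun a ha => ?_
    have hsplit : ∀ x, ∑ ψ, a ψ * (ψ x : ℂ) = ∑ ψ, (if ψ ∈ D then a ψ else 0) * (ψ x : ℂ) +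
        ∑ ψ, (if ψ ∈ D then 0 else a ψ) * (ψ x : ℂ) := by
      intro x
      rw [← Finset.sum_add_distrib]
      refine Finset.sum_congr rfl fun ψ _ => ?_
      split_ifs <;> simp
    rw [hsplit, hsplit, hvan a ha g hg,
      hvan a ha (g * n) fun h => hg ((S.commutator.mul_mem_cancel_right hn).1 h)]
    congr 1
    refine Finset.sum_congr rfl fun ψ _ => ?_
    split_ifs with hψ
    · rw [map_mul, (S.singleton_mem_charParts_iff_commutator ψ).1 ((hD ψ).1 hψ) n hn, mul_one]
    · simp
  · exfalso
    -- A nontrivial element of the kernel of `μ` lies in the centre.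
    obtain ⟨x, hx1, hx⟩ : ∃ x : G, x ≠ 1 ∧ μ x = 1 := by
      by_contra! h
      have hinj : Function.Injective μ :=
        (injective_iff_map_eq_one μ).2 fun x hx => by_contra fun h1 => h x h1 hx
      have : IsCyclic G := isCyclic_of_injective_ringHom ((Units.coeHom ℂ).comp μ)
        (Units.val_injective.comp hinj)
      have h2 := IsCyclic.exponent_eq_card (α := G)
      have h3 : Monoid.exponent G ∣ p := Monoid.exponent_dvd_of_forall_pow_eq_one hexp
      rw [h2, hcard] at h3
      have := Nat.le_of_dvd hp.pos h3
      nlinarith [hp.two_le]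
    have hxZ : x ∈ S.center := by
      refine S.mem_center_of_forall fun ψ φ h => ?_
      by_cases hψ : ψ ∈ D
      · rw [S.singleton_mem_charParts_iff.1 ((hD ψ).1 hψ) φ h]
      · obtain ⟨i, l, hl, rfl⟩ := Subgroup.exists_eq_pow_mul hDI hμ ψ
        have hi := coprime_of_pow_mul_notMem hexp' hl hψ
        obtain ⟨k, hk, hik⟩ := hi.exists_coprime_mul_modEq_one hp.ne_zero
        have h1 := hpow k hk _ _ (S.charRel_mul_left ((hD _).1 (D.inv_mem hl)) h)
        rw [mul_comm _ l, inv_mul_cancel_left, ← pow_mul, hik.pow_eq (hexp' μ), pow_one] at h1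
        obtain ⟨m, hm⟩ := hpw _ h1
        have h2 : ((l x)⁻¹ * φ x) ^ k = 1 := by
          have := DFunLike.congr_fun hm x
          simpa [hx] using this
        have h3 : ((l x)⁻¹ * φ x) ^ p = 1 := by
          rw [mul_pow, inv_pow, ← map_pow, ← map_pow, hexp, map_one, map_one, inv_one, one_mul]
        have h4 : (l x)⁻¹ * φ x = 1 := by
          have := hik.pow_eq h3
          rwa [mul_comm i, pow_mul, h2, one_pow, pow_one, eq_comm] at this
        rw [← inv_mul_eq_one.1 h4]
        simp [hx]
    rw [hZ, Subgroup.mem_bot] at hxZ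
    exact hx1 hxZ

theorem isStarProductOver_bot (S : SupercharacterTheory G) (hexp : ∀ x : G, x ^ p = 1)
    (hZ : S.center = ⊤) : S.IsStarProductOver ⊥ := by
  have hexpQ : ∀ x : G ⧸ (⊥ : Subgroup G), x ^ p = 1 := fun x => by
    obtain ⟨g, rfl⟩ := QuotientGroup.mk_surjective x
    rw [← QuotientGroup.mk_pow, hexp, QuotientGroup.mk_one]
  have hexpN : ∀ x : (⊥ : Subgroup G), x ^ p = 1 := fun x => Subtype.ext (hexp x)
  have hrel : ∀ x y, S.classRel x y ↔ x = y := by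
    intro x y
    refine ⟨fun h => (S.mem_center_iff.1 (hZ ▸ Subgroup.mem_top x) y h).symm, ?_⟩
    rintro rfl
    exact S.classRel.refl _
  refine ⟨powTheory hexpN ⊥, powTheory hexpQ ⊥,
    isStarProduct_of_classRel (fun x y => ?_) fun g h _ => ?_⟩
  · rw [hrel, classRel_powTheory_bot, Subtype.ext_iff]
  · rw [hrel, classRel_powTheory_bot, QuotientGroup.eq, Subgroup.mem_bot, inv_mul_eq_one]

theorem commutator_lt_top_iff (S : SupercharacterTheory G) :
    S.commutator < ⊤ ↔ ∃ χ ∈ S.supercharacters, χ 1 = 1 ∧ χ ≠ 1 := by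
  rw [supercharacters_eq_range, lt_top_iff_ne_top]
  simp only [Set.exists_range_iff, superchar_apply_one_eq_one_iff, ne_eq, superchar_eq_one_iff,
    singleton_mem_charParts_iff_commutator]
  constructor
  · intro h
    by_contra! H
    refine h ((Subgroup.eq_top_iff' _).2 fun x => ?_)
    refine (CommGroup.forall_monoidHom_apply_eq_one_iff ℂ S.commutator x).1 fun φ hφ => ?_
    rw [H φ hφ, MonoidHom.one_apply]
  · rintro ⟨ψ, h1, h2⟩ e
    exact h2 (MonoidHom.ext fun x => h1 x (e ▸ Subgroup.mem_top x))

theorem bot_lt_center_iff (S : SupercharacterTheory G) :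
    ⊥ < S.center ↔ ∃ K ∈ S.classes, K ≠ {1} ∧ K.ncard = 1 := by
  rw [bot_lt_iff_ne_bot, Subgroup.ne_bot_iff_exists_ne_one]
  constructor
  · rintro ⟨⟨z, hz⟩, h1⟩
    exact ⟨{z}, hz, fun e => h1 (Subtype.ext (Set.singleton_injective e)), Set.ncard_singleton z⟩
  · rintro ⟨K, hK, h1, h2⟩
    obtain ⟨z, rfl⟩ := Set.ncard_eq_one.1 h2
    exact ⟨⟨z, hK⟩, fun e => h1 (by rw [show z = 1 from congrArg Subtype.val e])⟩

end ElementaryAbelian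

end SupercharacterTheory

theorem theoremB {p : ℕ} (hp : p.Prime) {G : Type*} [CommGroup G] [Finite G]
    (hcard : Nat.card G = p ^ 2) (hexp : Monoid.exponent G = p)
    (S : SupercharacterTheory G) :
    (S.commutator < ⊤ ↔ ∃ χ ∈ S.supercharacters, χ 1 = 1 ∧ χ ≠ 1) ∧
    (⊥ < S.center ↔ ∃ K ∈ S.classes, K ≠ {1} ∧ K.ncard = 1) ∧
    (S.commutator < ⊤ ∨ ⊥ < S.center →
      ((S.commutator < ⊤ ∧ S.IsStarProductOver S.commutator) ∨
        (⊥ < S.center ∧ S.IsStarProductOver S.center) ∨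
        S.IsDirectProductOver S.center S.commutator) ∧
      S.ComesFromAutomorphisms) := by
  have : Fact p.Prime := ⟨hp⟩
  have hexp' : ∀ x : G, x ^ p = 1 := fun x => hexp ▸ Monoid.pow_exponent_eq_one x
  have : Nontrivial G := by
    rw [← Finite.one_lt_card_iff_nontrivial, hcard]
    exact Nat.one_lt_pow two_ne_zero hp.one_lt
  refine ⟨S.commutator_lt_top_iff, S.bot_lt_center_iff, fun hor => ?_⟩
  by_cases hZtop : S.center = ⊤
  · have hN := S.commutator_eq_bot_iff.2 hZtop
    refine ⟨Or.inl ⟨hN ▸ bot_lt_top, ?_⟩, S.comesFromAutomorphisms_of_exists fun x y hxy => ?_⟩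
    · rw [hN]
      exact S.isStarProductOver_bot hexp' hZtop
    · exact ⟨1, fun x => S.classRel.refl x,
        (S.mem_center_iff.1 (hZtop ▸ Subgroup.mem_top x) y hxy).symm⟩
  by_cases hZbot : S.center = ⊥
  · have hlt : S.commutator < ⊤ := hor.resolve_right fun h => h.ne' hZbot
    have hN : Nat.card S.commutator = p := Subgroup.card_eq_of_ne_bot_of_ne_top hcard
      (fun e => hZtop (S.commutator_eq_bot_iff.1 e)) hlt.ne
    have hst := S.classRel_mul_of_center_eq_bot hcard hexp' hN hZbot
    exact ⟨Or.inl ⟨hlt, S.isStarProductOver_commutator_of_stable hcard hexp' hN hst⟩,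
      S.comesFromAutomorphisms_of_stable hcard hexp' hN hst⟩
  · have hZ : Nat.card S.center = p := Subgroup.card_eq_of_ne_bot_of_ne_top hcard hZbot hZtop
    refine ⟨Or.inr ?_, S.comesFromAutomorphisms_of_card_center hcard hexp' hZ⟩
    rcases S.classRel.stable_or_exists_powers hexp' hZ
      (Subgroup.card_quotient_eq_of_card hcard hZ) (fun z hz => S.mem_center_iff.1 hz)
      (fun z hz _ _ => S.classRel_mul_left hz)
      (fun m _ => S.classRel_pow_of_card hcard hexp' m) with hst | ⟨h, hh, hpw⟩
    · exact Or.inl ⟨bot_lt_iff_ne_bot.2 hZbot,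
        S.isStarProductOver_center_of_stable hcard hexp' hZ hst⟩
    · exact Or.inr (S.isDirectProductOver_of_powers hcard hexp' hZ hh hpw)
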